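/- **Setting.** Let $d\in\{2,3\}$, let $\Omega\subset\mathbb R^d$ be a polyhedral domain, and let $\mathcal T_h$ be a conforming simplicial mesh of $\Omega$ with faces $\mathcal F_h=\mathcal F_h^i\cup\mathcal F_h^\partial$ (interior and boundary faces) and face diameters $h_F$. On an interior face $F$ let $\bm n_F$ be a fixed unit normal pointing from one adjacent element $K^+$ to the other one $K^-$, and put $[\![\phi]\!]=\phi|_{K^+}-\phi|_{K^-}$, $\{\!\!\{\phi\}\!\!\}=\frac12(\phi|_{K^+}+\phi|_{K^-})$; on a boundary face let $\bm n_F$ be the outward unit normal and $[\![\phi]\!]=\{\!\!\{\phi\}\!\!\}=\phi|_K$. Write $\bm n|_F=\bm n_F$, $(\cdot,\cdot)$ for the $L^2(\Omega)$ inner product, $\nabla_h$ for the elementwise gradient, and $\langle\cdot,\cdot\rangle_{\mathcal F_h}$, $\langle\cdot,\cdot\rangle_{\mathcal F_h^i}$ for sums over faces of the $L^2(F)$ inner products. For an integer $k\ge 0$ let $$\bm V_h=\{\bm v\in L^2(\Omega)^d:\bm v|_K\in\mathcal P_{k+1}(K)^d\ \forall K\},\qquad Q_h=\{q\in L^2(\Omega):\textstyle\int_\Omega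 q=0,\ q|_K\in\mathcal P_k(K)\ \forall K\},$$ $$\bm V_h^{\rm div}=\{\bm v\in H({\rm div};\Omega):\bm v|_K\in\bm{\mathcal Q}_k(K)\ \forall K,\ \bm v\cdot\bm n|_{\partial\Omega}=0\},$$ where either $\bm{\mathcal Q}_k(K)=\mathcal P_k(K)^d+\mathcal P_k(K)\bm x$ for all $K$ (Raviart–Thomas) or $\bm{\mathcal Q}_k(K)=\mathcal P_{k+1}(K)^d$ for all $K$ (Brezzi–Douglas–Marini). Let $\theta\in\mathbb R$ ($\theta=0,1,-1$ correspond to the kinematic pressure, the Bernoulli function and the EMAC function, $P=p+\frac\theta2\bm u\cdot\bm u$), $\gamma\ge 0$, $T>0$, and let $\zeta=(\zeta_F)_{F\in\mathcal F_h}$ be non-negative constants. Define $$\begin{aligned}c_h^1(\bm u;\bm u,\bm v)={}&(\bm u\cdot\nabla_h\bm u,\bm v)+\tfrac12((\nabla_h\cdot\bm u)\bm u,\bm v)-\langle(\{\!\!\{\bm u\}\!\!\}\cdot\bm n)[\![\bm u]\!],\{\!\!\{\bm v\}\!\!\}\rangle_{\mathcal F_h^i}-\tfrac12\langle[\![\bm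 u]\!]\cdot\bm n,\{\!\!\{\bm u\cdot\bm v\}\!\!\}\rangle_{\mathcal F_h^i}\\&+\langle\zeta|\{\!\!\{\bm u\}\!\!\}\cdot\bm n|[\![\bm u]\!],[\![\bm v]\!]\rangle_{\mathcal F_h}+\theta\langle(\{\!\!\{\bm v\}\!\!\}\cdot\bm n)[\![\bm u]\!],\{\!\!\{\bm u\}\!\!\}\rangle_{\mathcal F_h^i}\\&+\tfrac\theta2\langle[\![\bm v]\!]\cdot\bm n,\{\!\!\{\bm u\cdot\bm u\}\!\!\}\rangle_{\mathcal F_h^i}-\theta(\bm v\cdot\nabla_h\bm u,\bm u)-\tfrac\theta2((\nabla_h\cdot\bm v)\bm u,\bm u),\\ c_h^2(\bm u;\bm u,\bm v)={}&(\bm u\cdot\nabla_h\bm u,\bm v)+\tfrac{1-\theta}2((\nabla_h\cdot\bm u)\bm u,\bm v)-\langle(\{\!\!\{\bm u\}\!\!\}\cdot\bm n)[\![\bm u]\!],\{\!\!\{\bm v\}\!\!\}\rangle_{\mathcal F_h^i}-\tfrac{1-\theta}2\langle[\![\bm u]\!]\cdot\bm n,\{\!\!\{\bm u\cdot\bm v\}\!\!\}\rangle_{\mathcal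 F_h^i}\\&+\langle\zeta|\{\!\!\{\bm u\}\!\!\}\cdot\bm n|[\![\bm u]\!],[\![\bm v]\!]\rangle_{\mathcal F_h}+\theta\langle(\{\!\!\{\bm v\}\!\!\}\cdot\bm n)[\![\bm u]\!],\{\!\!\{\bm u\}\!\!\}\rangle_{\mathcal F_h^i}-\theta(\bm v\cdot\nabla_h\bm u,\bm u),\\ b_h(\bm v,q)={}&(\nabla_h\cdot\bm v,q)-\langle[\![\bm v]\!]\cdot\bm n,\{\!\!\{q\}\!\!\}\rangle_{\mathcal F_h},\\ d_h(\bm u,\bm v)={}&\gamma\Big(\sum_{F\in\mathcal F_h}h_F^{-1}\langle[\![\bm u]\!]\cdot\bm n_F,[\![\bm v]\!]\cdot\bm n_F\rangle_F+(\nabla_h\cdot\bm u,\nabla_h\cdot\bm v)\Big).\end{aligned}$$ **Schemes.** A solution of a scheme is a pair $(\bm u_h,P_h)$ in which $\bm u_h$ is continuous on $[0,T]$ and differentiable on $(0,T]$ (one-sidedly at $T$), with values in $\bm V_h$ (in $\bm V_h^{\rm div}$ for Hdiv), $P_h(t)\in Q_h$ for $t\in(0,T]$, and the following holds for every $t\in(0,T]$.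 - dG1 ($c_h=c_h^1$) and dG2 ($c_h=c_h^2$): $(\partial_t\bm u_h,\bm v)+c_h(\bm u_h;\bm u_h,\bm v)-b_h(\bm v,P_h)+d_h(\bm u_h,\bm v)=0$ for all $\bm v\in\bm V_h$, and $b_h(\bm u_h,q)=0$ for all $q\in Q_h$. - Hdiv ($c_h=c_h^1$ or $c_h=c_h^2$): $(\partial_t\bm u_h,\bm v)+c_h(\bm u_h;\bm u_h,\bm v)-(\nabla\cdot\bm v,P_h)=0$ for all $\bm v\in\bm V_h^{\rm div}$, and $(\nabla\cdot\bm u_h,q)=0$ for all $q\in Q_h$. **Theorem 1 (Semi-discrete Stability Estimate).** If $\zeta_F\ge\frac12|1-\theta|$ for all $F\in\mathcal F_h^\partial$, then every solution of dG1 and every solution of dG2 satisfies $$\|\bm u_h(t)\|_{L^2(\Omega)}\le\|\bm u_h(0)\|_{L^2(\Omega)}\qquad\text{for all }0\le t\le T.$$ For arbitrary non-negative $\zeta_F$, every solution of Hdiv (with either family of shape functions and either convective form) satisfies the same estimate. -/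

import Mathlib

open MeasureTheory Set
open scoped ContDiff

noncomputable section

namespace EulerDG

/-- The Euclidean space `ℝ^d`. -/
abbrev E (d : ℕ) : Type := EuclideanSpace ℝ (Fin d)

/-- A conforming simplicial mesh of the polyhedral domain `Ω ⊆ ℝ^d`: a finite simplicial complex,
all of whose simplices are faces of `d`-simplices, that triangulates `closure Ω`.
The domain is open and lies on one side of its boundary (`interior_closure`). -/
structure Mesh (d : ℕ) (Ω : Set (E d)) where
  complex : Geometry.SimplicialComplex ℝ (E d)
  finite_faces : complex.faces.Finite
  pure : ∀ s ∈ complex.faces, ∃ t ∈ complex.faces, s ⊆ t ∧ t.card = d + 1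
  space_eq : complex.space = closure Ω
  interior_closure : interior (closure Ω) = Ω

namespace Mesh

variable {d : ℕ} {Ω : Set (E d)}

/-- The elements `K ∈ 𝒯_h`, given by their `d + 1` vertices. -/
abbrev Cell (M : Mesh d Ω) : Type := {s : Finset (E d) // s ∈ M.complex.faces ∧ s.card = d + 1}

/-- The faces `F ∈ ℱ_h`, i.e. the `(d-1)`-dimensional simplices, given by their `d` vertices. -/
abbrev Facet (M : Mesh d Ω) : Type := {s : Finset (E d) // s ∈ M.complex.faces ∧ s.card = d}

instance (M : Mesh d Ω) : Fintype M.Cell :=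
  (M.finite_faces.subset (fun _ h => h.1)).fintype

instance (M : Mesh d Ω) : Fintype M.Facet :=
  (M.finite_faces.subset (fun _ h => h.1)).fintype

variable (M : Mesh d Ω)

/-- The closed simplex occupied by an element. -/
def cellSet (K : M.Cell) : Set (E d) := convexHull ℝ (K.1 : Set (E d))

/-- The closed simplex occupied by a face. -/
def facetSet (F : M.Facet) : Set (E d) := convexHull ℝ (F.1 : Set (E d))

/-- Scalar functions on `Ω` that are polynomial on every element. An element has non-empty interior,
so the function on it and the polynomial determine each other. -/
abbrev BrokenScalar : Type := M.Cell → MvPolynomial (Fin d) ℝ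

/-- Vector fields on `Ω` that are polynomial on every element. -/
abbrev BrokenVector : Type := M.Cell → Fin d → MvPolynomial (Fin d) ℝ

variable {M}

/-- Values of the piece of `q` on an element. -/
def sval (q : M.BrokenScalar) (K : M.Cell) (x : E d) : ℝ := MvPolynomial.eval (fun j => x j) (q K)

/-- Values of the piece of `v` on an element. -/
def vval (v : M.BrokenVector) (K : M.Cell) (x : E d) : E d :=
  WithLp.toLp 2 (fun i => MvPolynomial.eval (fun j => x j) (v K i))

/-- The vector field on `ℝ^d` (supported in `closure Ω`) with the given pieces; it is set to zero
on the element boundaries, a null set. -/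
def toFun (v : M.BrokenVector) (x : E d) : E d :=
  ∑ K : M.Cell, (interior (M.cellSet K)).indicator (vval v K) x

/-- The broken divergence `∇_h · v`. -/
def div (v : M.BrokenVector) : M.BrokenScalar := fun K => ∑ i, MvPolynomial.pderiv i (v K i)

/-- The broken convective derivative `β · ∇_h v`. -/
def conv (β v : M.BrokenVector) : M.BrokenVector :=
  fun K i => ∑ j, β K j * MvPolynomial.pderiv j (v K i)

/-- The pointwise product `q v`. -/
def smulField (q : M.BrokenScalar) (v : M.BrokenVector) : M.BrokenVector := fun K i => q K * v K i

/-- The pointwise product `v · w`. -/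
def dot (v w : M.BrokenVector) : M.BrokenScalar := fun K => ∑ i, v K i * w K i

/-- The `L²(Ω)` inner product of scalar functions (summed over the elements). -/
def ipS (p q : M.BrokenScalar) : ℝ :=
  ∑ K : M.Cell, ∫ x in M.cellSet K, sval p K x * sval q K x

/-- The `L²(Ω)` inner product of vector fields (summed over the elements). -/
def ipV (v w : M.BrokenVector) : ℝ :=
  ∑ K : M.Cell, ∫ x in M.cellSet K, inner ℝ (vval v K x) (vval w K x)

end Mesh

/-- A mesh together with, for every face `F`, the elements `K⁺` and `K⁻` that contain it
(they coincide exactly when `F` is a boundary face, contained in a single element) and the fixed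
unit normal `n_F`, which points out of `K⁺`, and into `K⁻` when `F` is an interior face. -/
structure OrientedMesh (d : ℕ) (Ω : Set (E d)) extends Mesh d Ω where
  plus : toMesh.Facet → toMesh.Cell
  minus : toMesh.Facet → toMesh.Cell
  normal : toMesh.Facet → E d
  subset_iff : ∀ (F : toMesh.Facet) (K : toMesh.Cell), F.1 ⊆ K.1 ↔ K = plus F ∨ K = minus F
  norm_normal : ∀ F, ‖normal F‖ = 1
  normal_plus : ∀ F, ∀ x ∈ toMesh.facetSet F, ∀ y ∈ toMesh.cellSet (plus F),
    inner ℝ (normal F) (y - x) ≤ 0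
  normal_minus : ∀ F, plus F ≠ minus F → ∀ x ∈ toMesh.facetSet F,
    ∀ y ∈ toMesh.cellSet (minus F), 0 ≤ inner ℝ (normal F) (y - x)

namespace OrientedMesh

open Mesh

variable {d : ℕ} {Ω : Set (E d)} (M : OrientedMesh d Ω)

abbrev Facet : Type := M.toMesh.Facet
abbrev BrokenScalar : Type := M.toMesh.BrokenScalar
abbrev BrokenVector : Type := M.toMesh.BrokenVector

/-- `F ∈ ℱ_h^i`. -/
def IsInterior (F : M.Facet) : Prop := M.plus F ≠ M.minus F

/-- `F ∈ ℱ_h^∂`. -/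
def IsBoundary (F : M.Facet) : Prop := M.plus F = M.minus F

/-- The jump `⟦f⟧` on the face `F`. -/
def jump {V : Type} [AddCommGroup V] (f : M.toMesh.Cell → E d → V) (F : M.Facet) (x : E d) : V :=
  open Classical in
  if M.IsInterior F then f (M.plus F) x - f (M.minus F) x else f (M.plus F) x

/-- The average `{f}` on the face `F`. -/
def avg {V : Type} [AddCommGroup V] [Module ℝ V] (f : M.toMesh.Cell → E d → V) (F : M.Facet)
    (x : E d) : V :=
  open Classical in
  if M.IsInterior F then (1 / 2 : ℝ) • (f (M.plus F) x + f (M.minus F) x) else f (M.plus F) x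

/-- The integral over the face `F` with respect to the `(d-1)`-dimensional surface measure. -/
def facetIntegral (F : M.Facet) (g : E d → ℝ) : ℝ :=
  ∫ x in M.toMesh.facetSet F, g x ∂(Measure.euclideanHausdorffMeasure (d - 1))

/-- Integration over all faces. -/
def sumAll (g : M.Facet → E d → ℝ) : ℝ := ∑ F : M.Facet, M.facetIntegral F (g F)

/-- Integration over the interior faces. -/
def sumInt (g : M.Facet → E d → ℝ) : ℝ :=
  open Classical in
  ∑ F : M.Facet, if M.IsInterior F then M.facetIntegral F (g F) else 0

variable {M}

/-- The normal component of the jump, `⟦v⟧ · n`. -/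
def jumpN (v : M.BrokenVector) (F : M.Facet) (x : E d) : ℝ :=
  inner ℝ (M.jump (vval v) F x) (M.normal F)

/-- The normal component of the average, `{v} · n`. -/
def avgN (v : M.BrokenVector) (F : M.Facet) (x : E d) : ℝ :=
  inner ℝ (M.avg (vval v) F x) (M.normal F)

/-- The convective form `c_h¹(u; u, v)`. -/
def c1 (θ : ℝ) (ζ : M.Facet → ℝ) (u v : M.BrokenVector) : ℝ :=
  ipV (conv u u) v + 1 / 2 * ipV (smulField (div u) u) v
  - M.sumInt (fun F x => avgN u F x * inner ℝ (M.jump (vval u) F x) (M.avg (vval v) F x))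
  - 1 / 2 * M.sumInt (fun F x => jumpN u F x * M.avg (sval (dot u v)) F x)
  + M.sumAll (fun F x => ζ F * |avgN u F x| *
      inner ℝ (M.jump (vval u) F x) (M.jump (vval v) F x))
  + θ * M.sumInt (fun F x => avgN v F x * inner ℝ (M.jump (vval u) F x) (M.avg (vval u) F x))
  + θ / 2 * M.sumInt (fun F x => jumpN v F x * M.avg (sval (dot u u)) F x)
  - θ * ipV (conv v u) u - θ / 2 * ipV (smulField (div v) u) u

/-- The convective form `c_h²(u; u, v)`. -/
def c2 (θ : ℝ) (ζ : M.Facet → ℝ) (u v : M.BrokenVector) : ℝ :=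
  ipV (conv u u) v + (1 - θ) / 2 * ipV (smulField (div u) u) v
  - M.sumInt (fun F x => avgN u F x * inner ℝ (M.jump (vval u) F x) (M.avg (vval v) F x))
  - (1 - θ) / 2 * M.sumInt (fun F x => jumpN u F x * M.avg (sval (dot u v)) F x)
  + M.sumAll (fun F x => ζ F * |avgN u F x| *
      inner ℝ (M.jump (vval u) F x) (M.jump (vval v) F x))
  + θ * M.sumInt (fun F x => avgN v F x * inner ℝ (M.jump (vval u) F x) (M.avg (vval u) F x))
  - θ * ipV (conv v u) u

/-- The divergence form `b_h(v, q)`. -/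
def b (v : M.BrokenVector) (q : M.BrokenScalar) : ℝ :=
  ipS (div v) q - M.sumAll (fun F x => jumpN v F x * M.avg (sval q) F x)

/-- The penalty form `d_h(u, v)`; `h_F` is the diameter of `F`. -/
def pen (γ : ℝ) (u v : M.BrokenVector) : ℝ :=
  γ * (∑ F : M.Facet, (Metric.diam (M.toMesh.facetSet F))⁻¹ *
      M.facetIntegral F (fun x => jumpN u F x * jumpN v F x) + ipS (div u) (div v))

variable (M)

/-- `V_h`: piecewise polynomial vector fields of degree at most `k + 1`. -/
def Vh (k : ℕ) : Set M.BrokenVector := {v | ∀ K i, (v K i).totalDegree ≤ k + 1}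

/-- `Q_h`: piecewise polynomials of degree at most `k` with zero mean on `Ω`. -/
def Qh (k : ℕ) : Set M.BrokenScalar :=
  {q | (∀ K, (q K).totalDegree ≤ k) ∧ (∑ K, ∫ x in M.toMesh.cellSet K, sval q K x) = 0}

/-- `f ∈ H(div; Ω)`: `f` is square integrable with a square integrable weak divergence `g`. -/
def MemHdiv (Ω : Set (E d)) (f : E d → E d) : Prop :=
  MemLp f 2 (volume.restrict Ω) ∧ ∃ g : E d → ℝ, MemLp g 2 (volume.restrict Ω) ∧
    ∀ φ : E d → ℝ, ContDiff ℝ ∞ φ → HasCompactSupport φ → tsupport φ ⊆ Ω →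
      ∫ x in Ω, fderiv ℝ φ x (f x) = - ∫ x in Ω, g x * φ x

/-- The two families of `H(div)` elements. -/
inductive HdivFamily : Type
  | raviartThomas
  | brezziDouglasMarini

/-- The shape function spaces: `[P_k]^d + P_k x` (RT) and `[P_{k+1}]^d` (BDM). -/
def shape (d k : ℕ) : HdivFamily → Set (Fin d → MvPolynomial (Fin d) ℝ)
  | .raviartThomas => {v | ∃ (a : Fin d → MvPolynomial (Fin d) ℝ) (p : MvPolynomial (Fin d) ℝ),
      (∀ i, (a i).totalDegree ≤ k) ∧ p.totalDegree ≤ k ∧ ∀ i, v i = a i + p * MvPolynomial.X i}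
  | .brezziDouglasMarini => {v | ∀ i, (v i).totalDegree ≤ k + 1}

/-- `V_h^div`: fields in `H(div; Ω)` with the given shape functions and zero normal component on the
boundary faces. -/
def VhDiv (fam : HdivFamily) (k : ℕ) : Set M.BrokenVector :=
  {v | MemHdiv Ω (toFun v) ∧ (∀ K, v K ∈ shape d k fam) ∧
    ∀ F, M.IsBoundary F → ∀ x ∈ M.toMesh.facetSet F,
      inner ℝ (vval v (M.plus F) x) (M.normal F) = 0}

variable {M}

/-- `u` is a time-dependent field with values in the space `V`, continuous on `[0, T]`. As `V` is
finite-dimensional, continuity and differentiability in time are those of all the coefficients. -/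
def ContinuousInTime (T : ℝ) (u : ℝ → M.BrokenVector) : Prop :=
  ∀ K i m, ContinuousOn (fun s => (u s K i).coeff m) (Icc 0 T)

/-- `u` has time derivative `u'` at the time `t` (one-sided at the ends of `[0, T]`). -/
def HasTimeDeriv (T : ℝ) (u : ℝ → M.BrokenVector) (u' : M.BrokenVector) (t : ℝ) : Prop :=
  ∀ K i m, HasDerivWithinAt (fun s => (u s K i).coeff m) ((u' K i).coeff m) (Icc 0 T) t

/-- `(u, P)` solves the semi-discrete dG scheme with convective form `c(u; u, v) = c u v`:
`(∂ₜu, v) + c(u; u, v) - b_h(v, P) + d_h(u, v) = 0` for all `v ∈ V_h` and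
`b_h(u, q) = 0` for all `q ∈ Q_h`, at every time `t ∈ (0, T]`. -/
structure SolvesDG (c : M.BrokenVector → M.BrokenVector → ℝ) (k : ℕ) (γ T : ℝ)
    (u : ℝ → M.BrokenVector) (P : ℝ → M.BrokenScalar) : Prop where
  mem_Vh : ∀ t ∈ Icc 0 T, u t ∈ M.Vh k
  mem_Qh : ∀ t ∈ Ioc 0 T, P t ∈ M.Qh k
  cont : ContinuousInTime T u
  momentum : ∀ t ∈ Ioc 0 T, ∃ u' : M.BrokenVector, HasTimeDeriv T u u' t ∧
    ∀ v ∈ M.Vh k, ipV u' v + c (u t) v - b v (P t) + pen γ (u t) v = 0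
  mass : ∀ t ∈ Ioc 0 T, ∀ q ∈ M.Qh k, b (u t) q = 0

/-- The scheme dG1. -/
def SolvesDG1 (θ : ℝ) (ζ : M.Facet → ℝ) (k : ℕ) (γ T : ℝ)
    (u : ℝ → M.BrokenVector) (P : ℝ → M.BrokenScalar) : Prop :=
  SolvesDG (c1 θ ζ) k γ T u P

/-- The scheme dG2. -/
def SolvesDG2 (θ : ℝ) (ζ : M.Facet → ℝ) (k : ℕ) (γ T : ℝ)
    (u : ℝ → M.BrokenVector) (P : ℝ → M.BrokenScalar) : Prop :=
  SolvesDG (c2 θ ζ) k γ T u P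

/-- `(u, P)` solves the `H(div)`-conforming scheme with convective form `c(u; u, v) = c u v`:
`(∂ₜu, v) + c(u; u, v) - (∇·v, P) = 0` for all `v ∈ V_h^div` and
`(∇·u, q) = 0` for all `q ∈ Q_h`, at every time `t ∈ (0, T]`. -/
structure SolvesHdiv (c : M.BrokenVector → M.BrokenVector → ℝ) (fam : HdivFamily) (k : ℕ) (T : ℝ)
    (u : ℝ → M.BrokenVector) (P : ℝ → M.BrokenScalar) : Prop where
  mem_VhDiv : ∀ t ∈ Icc 0 T, u t ∈ M.VhDiv fam k
  mem_Qh : ∀ t ∈ Ioc 0 T, P t ∈ M.Qh k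
  cont : ContinuousInTime T u
  momentum : ∀ t ∈ Ioc 0 T, ∃ u' : M.BrokenVector, HasTimeDeriv T u u' t ∧
    ∀ v ∈ M.VhDiv fam k, ipV u' v + c (u t) v - ipS (div v) (P t) = 0
  mass : ∀ t ∈ Ioc 0 T, ∀ q ∈ M.Qh k, ipS (div (u t)) q = 0

end OrientedMesh

/-- The norm of `L²(Ω)^d` (finite on piecewise polynomial fields). -/
def normL2 {d : ℕ} {Ω : Set (E d)} {M : Mesh d Ω} (v : M.BrokenVector) : ENNReal :=
  eLpNorm (Mesh.toFun v) 2 (volume.restrict Ω)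

end EulerDG

end

/-! The proof is an energy argument. Testing the momentum equation with `v = u` and the mass
equation with `q = P` removes the pressure. Half the time derivative of `ipV u u` is then minus the
convective form at `(u, u)`, minus a non-negative penalty in the dG case, so it suffices that the
convective form is non-negative there.

At `v = u` the forms `c1` and `c2` coincide, and their volume and interior-face terms all carry the
factor `1 - θ`. These terms are `(1 - θ) / 2` times the difference between the elementwise integral
of `div (|u|² u)` and the interior-face sum of its normal jumps. By the divergence theorem on each
simplex this difference is the energy flux through the boundary, which gives `c1_self`: boundary
flux plus upwind term. The lower bound on `ζ` lets the upwind term absorb the flux; for the H(div)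
scheme the flux vanishes because the normal trace does.

The divergence theorem (`setIntegral_simplex_fderiv`) is proved for derivatives along an edge
direction, where Fubini and the fundamental theorem of calculus leave only the two faces that the
edge crosses; edges at one vertex span all directions. Finally, `ipV u u` is a quadratic form in
finitely many time-dependent coefficients, so it can be differentiated in time, and its square root
is the `L²` norm since elements overlap only in null sets. -/

noncomputable section

namespace EulerDG

/-! ### Fubini along oblique lines, and surface measure on hyperplanes -/

section Slicing

open Module

variable {V : Type*} [NormedAddCommGroup V] [InnerProductSpace ℝ V] [FiniteDimensional ℝ V]
  [MeasurableSpace V] [BorelSpace V]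

/-- Slicing by lines parallel to a unit vector `n`, based at the hyperplane through the origin
orthogonal to `n`. -/
theorem exists_measurePreserving_slices {n : V} (hn : ‖n‖ = 1) :
    ∃ e : ℝ × (ℝ ∙ n)ᗮ ≃ᵐ V, MeasurePreserving e ∧ ∀ z, e z = z.1 • n + (z.2 : V) := by
  have h1 := ((ℝ ∙ n).measurePreserving_measurableEquivProd (0 : V)).symm
  rw [InnerProductSpace.euclideanHausdorffMeasure_eq_volume] at h1
  let f := LinearIsometryEquiv.toSpanUnitSingleton (𝕜 := ℝ) n hn
  have h3 := f.measurePreserving.prod (MeasurePreserving.id (volume : Measure (ℝ ∙ n)ᗮ))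
  refine ⟨(f.toMeasurableEquiv.prodCongr (MeasurableEquiv.refl _)).trans
    ((ℝ ∙ n).measurableEquivProd (0 : V)).symm, h1.comp h3, fun z => ?_⟩
  change ((f z.1 : V) + (z.2 : V)) + (0 : V) = _
  simp [f]

/-- The volume as an iterated integral along lines parallel to `v`, based at the hyperplane through
`x₀` with unit normal `n`. -/
theorem integral_eq_integral_slices {n v : V} (hn : ‖n‖ = 1) (hv : inner ℝ n v ≠ 0) (x₀ : V)
    {G : V → ℝ} (hG : Integrable G) :
    ∫ x, G x = |inner ℝ n v| * ∫ y : (ℝ ∙ n)ᗮ, ∫ s : ℝ, G (x₀ + y + s • v) := by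
  -- The transvection fixes the hyperplane orthogonal to `n` and sends `n` to `v`, so it carries
  -- orthogonal slices to slices along `v`; its determinant `⟪n, v⟫` is the Jacobian factor.
  let T : V →ₗ[ℝ] V := LinearMap.transvection (innerₛₗ ℝ n) (v - n)
  have hdet : LinearMap.det T = inner ℝ n v := by
    rw [LinearMap.transvection.det]
    simp [inner_sub_right, hn]
  have hdet0 : LinearMap.det T ≠ 0 := by rwa [hdet]
  have hmap := Measure.map_linearMap_addHaar_eq_smul_addHaar (volume : Measure V) hdet0
  have hTe : MeasurableEmbedding T := by
    have h2 := (T.equivOfDetNeZero hdet0).toContinuousLinearEquiv.toHomeomorph.measurableEmbedding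
    exact h2
  have hpos : 0 < |inner ℝ n v| := abs_pos.mpr hv
  let G' : V → ℝ := fun x => G (x₀ + x)
  have hG' : Integrable G' := hG.comp_add_left x₀
  have hGT : Integrable (fun x => G' (T x)) := by
    have : Integrable G' (Measure.map T volume) := by
      rw [hmap]; exact hG'.smul_measure ENNReal.ofReal_ne_top
    exact (hTe.integrable_map_iff).1 this
  have e1 : ∫ x, G' (T x) = |inner ℝ n v|⁻¹ * ∫ x, G x := by
    rw [← hTe.integral_map, hmap, integral_smul_measure, hdet, abs_inv,
      ENNReal.toReal_ofReal (by positivity), smul_eq_mul]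
    congr 1
    exact integral_add_left_eq_self G x₀
  obtain ⟨e, hsl, he⟩ := exists_measurePreserving_slices hn
  have e2 := hsl.integral_comp e.measurableEmbedding (fun x => G' (T x))
  have hint : Integrable (fun z : ℝ × (ℝ ∙ n)ᗮ => G' (T (e z))) :=
    (hsl.integrable_comp_emb e.measurableEmbedding).2 hGT
  have e3 : ∀ (s : ℝ) (y : (ℝ ∙ n)ᗮ), G' (T (e (s, y))) = G (x₀ + y + s • v) := by
    intro s y
    have hy : inner ℝ n (y : V) = 0 := Submodule.mem_orthogonal_singleton_iff_inner_right.1 y.2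
    have : T (e (s, y)) = y + s • v := by
      simp only [he, T, LinearMap.transvection.apply, innerₛₗ_apply_apply, inner_add_right, inner_smul_right,
        hy, real_inner_self_eq_norm_sq, hn]
      module
    simp only [G', this, add_assoc]
  rw [Measure.volume_eq_prod, integral_prod_symm _ hint] at e2
  simp only [e3] at e2
  rw [e2, e1, mul_inv_cancel_left₀ hpos.ne']

theorem measurableEmbedding_const_add_orthogonal (n x₀ : V) :
    MeasurableEmbedding (fun y : (ℝ ∙ n)ᗮ => x₀ + (y : V)) :=
  (measurableEmbedding_addLeft x₀).comp
    (MeasurableEmbedding.subtype_coe (Submodule.closed_of_finiteDimensional _).measurableSet)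

/-- The translated inclusion of the hyperplane is an isometry, so it transports Hausdorff measure,
which in the hyperplane's own dimension is its Lebesgue measure. This puts surface integrals over
the same base as the slices. -/
theorem restrict_euclideanHausdorffMeasure_eq_map {m : ℕ} {n : V} (hm : finrank ℝ (ℝ ∙ n)ᗮ = m)
    (x₀ : V) {S : Set V} (hS : ∀ x ∈ S, inner ℝ n (x - x₀) = 0) (hSm : MeasurableSet S) :
    (Measure.euclideanHausdorffMeasure m : Measure V).restrict S =
      ((volume : Measure (ℝ ∙ n)ᗮ).map (fun y : (ℝ ∙ n)ᗮ => x₀ + (y : V))).restrict S := by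
  have hi : Isometry (fun y : (ℝ ∙ n)ᗮ => x₀ + (y : V)) :=
    (IsometryEquiv.addLeft x₀).isometry.comp isometry_subtype_coe
  have hr := hi.map_euclideanHausdorffMeasure (d := m)
  have hv : (Measure.euclideanHausdorffMeasure m : Measure (ℝ ∙ n)ᗮ) = volume := by
    rw [← hm]; exact InnerProductSpace.euclideanHausdorffMeasure_eq_volume
  rw [hv] at hr
  rw [hr, Measure.restrict_restrict hSm]
  congr 1
  symm
  apply inter_eq_left.2
  intro x hx
  exact ⟨⟨x - x₀, Submodule.mem_orthogonal_singleton_iff_inner_right.2 (hS x hx)⟩, by simp⟩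

theorem setIntegral_euclideanHausdorffMeasure {m : ℕ} {n : V} (hm : finrank ℝ (ℝ ∙ n)ᗮ = m)
    (x₀ : V) {S : Set V} (hS : ∀ x ∈ S, inner ℝ n (x - x₀) = 0) (hSm : MeasurableSet S)
    (g : V → ℝ) :
    ∫ x in S, g x ∂(Measure.euclideanHausdorffMeasure m) =
      ∫ y : (ℝ ∙ n)ᗮ, S.indicator g (x₀ + y) := by
  rw [restrict_euclideanHausdorffMeasure_eq_map hm x₀ hS hSm, ← integral_indicator hSm,
    (measurableEmbedding_const_add_orthogonal n x₀).integral_map]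

theorem integrableOn_euclideanHausdorffMeasure {m : ℕ} {n : V} (hm : finrank ℝ (ℝ ∙ n)ᗮ = m)
    (x₀ : V) {S : Set V} (hS : ∀ x ∈ S, inner ℝ n (x - x₀) = 0) (hSc : IsCompact S)
    {g : V → ℝ} (hg : ContinuousOn g S) :
    IntegrableOn g S (Measure.euclideanHausdorffMeasure m) := by
  have he := measurableEmbedding_const_add_orthogonal n x₀
  have hfin : Fact ((Measure.euclideanHausdorffMeasure m : Measure V) S < ⊤) := by
    constructor
    rw [← Measure.restrict_apply_self, restrict_euclideanHausdorffMeasure_eq_map hm x₀ hS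
      hSc.measurableSet, Measure.restrict_apply_self, he.map_apply]
    have hcl : Topology.IsClosedEmbedding (fun y : (ℝ ∙ n)ᗮ => x₀ + (y : V)) :=
      (Homeomorph.addLeft x₀).isClosedEmbedding.comp
        (Submodule.closed_of_finiteDimensional _).isClosedEmbedding_subtypeVal
    exact (hcl.isCompact_preimage hSc).measure_lt_top
  obtain ⟨C, hC⟩ := hSc.exists_bound_of_continuousOn hg
  exact Integrable.of_bound (hg.aestronglyMeasurable_of_isCompact hSc hSc.measurableSet) C
    ((ae_restrict_iff' hSc.measurableSet).2 (Filter.Eventually.of_forall hC))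

end Slicing

/-! ### The divergence theorem on a simplex -/

section SimplexDivergence

open Module

variable {ι V : Type*} [NormedAddCommGroup V] [InnerProductSpace ℝ V]

/-- The face of a simplex opposite to the vertex `b i`. -/
def simplexFace (b : AffineBasis ι ℝ V) (i : ι) : Set V :=
  {x | b.coord i x = 0 ∧ ∀ j, 0 ≤ b.coord j x}

theorem simplexFace_subset_convexHull (b : AffineBasis ι ℝ V) (i : ι) :
    simplexFace b i ⊆ convexHull ℝ (range b) := fun _ hx => by
  rw [b.convexHull_eq_nonneg_coord]; exact hx.2

theorem mem_simplexFace_of_ne (b : AffineBasis ι ℝ V) {i j : ι} (h : i ≠ j) :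
    b j ∈ simplexFace b i := by
  classical
  refine ⟨b.coord_apply_ne h, fun k => ?_⟩
  rw [b.coord_apply]; split_ifs <;> norm_num

/-- Edge directions are chosen because moving along one trades coordinate `j` for coordinate `i` and
fixes all others, so a line can cross only the faces opposite to `b i` and `b j`. -/
theorem coord_add_smul_edge (b : AffineBasis ι ℝ V) (i j k : ι) (x : V) (s : ℝ) :
    b.coord k (x + s • (b i - b j)) = b.coord k x + s * (b.coord k (b i) - b.coord k (b j)) := by
  have h1 : b.coord k (x + s • (b i - b j)) = (b.coord k).linear (s • (b i - b j)) + b.coord k x := by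
    rw [add_comm]; exact (b.coord k).map_vadd x _
  have h2 : (b.coord k).linear (b i - b j) = b.coord k (b i) - b.coord k (b j) :=
    (b.coord k).linearMap_vsub (b i) (b j)
  rw [h1, map_smul, h2, smul_eq_mul, add_comm]

theorem coord_add_smul_edge_left (b : AffineBasis ι ℝ V) {i j : ι} (h : i ≠ j) (x : V) (s : ℝ) :
    b.coord i (x + s • (b i - b j)) = b.coord i x + s := by
  rw [coord_add_smul_edge, b.coord_apply_eq, b.coord_apply_ne h]; ring

theorem coord_add_smul_edge_right (b : AffineBasis ι ℝ V) {i j : ι} (h : i ≠ j) (x : V) (s : ℝ) :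
    b.coord j (x + s • (b i - b j)) = b.coord j x - s := by
  rw [coord_add_smul_edge, b.coord_apply_eq, b.coord_apply_ne h.symm]; ring

theorem coord_add_smul_edge_of_ne (b : AffineBasis ι ℝ V) {i j k : ι} (hi : k ≠ i) (hj : k ≠ j)
    (x : V) (s : ℝ) : b.coord k (x + s • (b i - b j)) = b.coord k x := by
  rw [coord_add_smul_edge, b.coord_apply_ne hi, b.coord_apply_ne hj]; ring

variable [Fintype ι]

theorem sub_eq_sum_coord_smul (b : AffineBasis ι ℝ V) (x p : V) :
    x - p = ∑ k, b.coord k x • (b k - p) := by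
  simp only [smul_sub, Finset.sum_sub_distrib, b.linear_combination_coord_eq_self,
    ← Finset.sum_smul, b.sum_coord_apply_eq_one, one_smul]

/-- `n` is the outward unit normal of the simplex on its face opposite to `b i`. -/
structure IsOutwardNormal (b : AffineBasis ι ℝ V) (i : ι) (n : V) : Prop where
  norm_eq : ‖n‖ = 1
  inner_nonpos : ∀ x ∈ simplexFace b i, ∀ y ∈ convexHull ℝ (range b), inner ℝ n (y - x) ≤ 0

variable {b : AffineBasis ι ℝ V} {i j : ι} {n : V}

/-- For `k ≠ i` both `b k` and `b j` lie on the face, and the normal inequality used in both orders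
makes `n` orthogonal to their difference. Only the `i` term of the barycentric expansion survives.
-/
theorem IsOutwardNormal.inner_sub (hn : IsOutwardNormal b i n) (h : i ≠ j) (x : V) :
    inner ℝ n (x - b j) = b.coord i x * inner ℝ n (b i - b j) := by
  rw [sub_eq_sum_coord_smul b x (b j), inner_sum, Finset.sum_eq_single i]
  · rw [inner_smul_right]
  · intro k _ hk
    have hj := mem_simplexFace_of_ne b h
    have hk := mem_simplexFace_of_ne b hk.symm
    have h1 := hn.inner_nonpos _ hj _ (simplexFace_subset_convexHull b i hk)
    have h2 := hn.inner_nonpos _ hk _ (simplexFace_subset_convexHull b i hj)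
    rw [← neg_sub, inner_neg_right] at h2
    rw [inner_smul_right, le_antisymm h1 (by linarith), mul_zero]
  · simp

/-- If the product vanished, `inner_sub` would make `n` orthogonal to every vector, including
itself. -/
theorem IsOutwardNormal.inner_edge_neg (hn : IsOutwardNormal b i n) (h : i ≠ j) :
    inner ℝ n (b i - b j) < 0 := by
  refine lt_of_le_of_ne (hn.inner_nonpos _ (mem_simplexFace_of_ne b h) _
    (subset_convexHull ℝ _ (mem_range_self i))) fun h0 => ?_
  have := hn.inner_sub h (b j + n)
  rw [h0, mul_zero, add_sub_cancel_left, real_inner_self_eq_norm_sq, hn.norm_eq] at this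
  norm_num at this

theorem IsOutwardNormal.coord_eq_zero (hn : IsOutwardNormal b i n) (h : i ≠ j) (y : (ℝ ∙ n)ᗮ) :
    b.coord i (b j + y) = 0 := by
  have := hn.inner_sub h (b j + y)
  rw [add_sub_cancel_left, Submodule.mem_orthogonal_singleton_iff_inner_right.1 y.2] at this
  exact (mul_eq_zero.1 this.symm).resolve_right (hn.inner_edge_neg h).ne

theorem IsOutwardNormal.inner_eq_zero (hn : IsOutwardNormal b i n) (h : i ≠ j) {x : V}
    (hx : x ∈ simplexFace b i) : inner ℝ n (x - b j) = 0 := by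
  rw [hn.inner_sub h, hx.1, zero_mul]

variable [FiniteDimensional ℝ V]

theorem isCompact_simplexFace (b : AffineBasis ι ℝ V) (i : ι) : IsCompact (simplexFace b i) := by
  refine (Set.finite_range b).isCompact_convexHull (𝕜 := ℝ).of_isClosed_subset ?_
    (simplexFace_subset_convexHull b i)
  rw [simplexFace, ofPred_and, ofPred_forall]
  exact (isClosed_eq (continuous_barycentric_coord b i) continuous_const).inter
    (isClosed_iInter fun j => isClosed_le continuous_const (continuous_barycentric_coord b j))

variable [MeasurableSpace V] [BorelSpace V]

/-- The projection of the face opposite to `b i` onto the face opposite to `b j` along their common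
edge direction scales the surface measure by the ratio of the normal components. -/
theorem setIntegral_simplexFace_shift {m : ℕ} (hm : finrank ℝ V = m + 1) {n' : V}
    (hn : IsOutwardNormal b i n) (hn' : IsOutwardNormal b j n') (h : i ≠ j) {g : V → ℝ}
    (hg : Continuous g) :
    |inner ℝ n (b i - b j)| * ∫ x in simplexFace b i, g (x + b.coord j x • (b i - b j))
        ∂(Measure.euclideanHausdorffMeasure m) =
      |inner ℝ n' (b i - b j)| * ∫ x in simplexFace b j, g x
        ∂(Measure.euclideanHausdorffMeasure m) := by
  classical
  set v := b i - b j with hv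
  have : Fact (finrank ℝ V = m + 1) := ⟨hm⟩
  have hcn : inner ℝ n v ≠ 0 := (hn.inner_edge_neg h).ne
  have hcn' : inner ℝ n' v ≠ 0 := by
    rw [hv, ← neg_sub, inner_neg_right]; exact (neg_pos.2 (hn'.inner_edge_neg h.symm)).ne'
  have hr : finrank ℝ (ℝ ∙ n)ᗮ = m :=
    Submodule.finrank_orthogonal_span_singleton (norm_ne_zero_iff.1 (by rw [hn.norm_eq]; norm_num))
  have hr' : finrank ℝ (ℝ ∙ n')ᗮ = m :=
    Submodule.finrank_orthogonal_span_singleton (norm_ne_zero_iff.1 (by rw [hn'.norm_eq]; norm_num))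
  -- Projection along `v` onto the hyperplane of the face opposite to `b j`.
  let π : V → V := fun x => x + b.coord j x • v
  have hπ : Continuous π := by
    have := continuous_barycentric_coord b j
    fun_prop
  have hπs : ∀ x (s : ℝ), π (x + s • v) = π x := by
    intro x s
    simp only [π, hv, coord_add_smul_edge_right b h]
    module
  -- A prism over the face opposite to `b j`, of length one in the direction `v`. Slicing `g ∘ π`
  -- over it from either of the two face hyperplanes gives the two sides of the identity.
  let C : Set V := {x | π x ∈ simplexFace b j ∧ b.coord j x ∈ Icc (0 : ℝ) 1}
  have hC : IsCompact C := by
    have : C = (fun z : V × ℝ => z.1 - z.2 • v) '' (simplexFace b j ×ˢ Icc 0 1) := by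
      ext x
      constructor
      · intro hx
        exact ⟨(π x, b.coord j x), ⟨hx.1, hx.2⟩, by simp [π]⟩
      · rintro ⟨⟨z, s⟩, ⟨hz, hs⟩, rfl⟩
        have hz0 : b.coord j z = 0 := hz.1
        have e1 : b.coord j (z - s • v) = s := by
          have := coord_add_smul_edge_right b h z (-s)
          rw [neg_smul, ← sub_eq_add_neg, hz0] at this
          rw [hv, this]; ring
        refine ⟨?_, ?_⟩
        · have : π (z - s • v) = z := by simp [π, e1]
          rwa [this]
        · change b.coord j (z - s • v) ∈ _
          rw [e1]; exact hs
    rw [this]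
    exact ((isCompact_simplexFace b j).prod isCompact_Icc).image (by fun_prop)
  let G : V → ℝ := C.indicator (fun x => g (π x))
  have hG : Integrable G :=
    ((hg.comp hπ).continuousOn.integrableOn_compact hC).integrable_indicator hC.measurableSet
  have hline : ∀ x, ∫ s : ℝ, G (x + s • v) = (simplexFace b j).indicator g (π x) := by
    intro x
    have : ∀ s : ℝ, G (x + s • v) = (Icc (b.coord j x - 1) (b.coord j x)).indicator
        (fun _ => (simplexFace b j).indicator g (π x)) s := by
      intro s
      have hmem : x + s • v ∈ C ↔ π x ∈ simplexFace b j ∧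
          s ∈ Icc (b.coord j x - 1) (b.coord j x) := by
        simp only [C, mem_ofPred_eq, hπs, mem_Icc]
        rw [hv, coord_add_smul_edge_right b h]
        constructor <;> rintro ⟨h1, h2, h3⟩ <;> refine ⟨h1, ?_, ?_⟩ <;> linarith
      simp only [G, indicator_apply, hmem, hπs]
      by_cases h1 : π x ∈ simplexFace b j <;> simp [h1]
    simp only [this]
    rw [integral_indicator measurableSet_Icc]
    simp
  have e1 := integral_eq_integral_slices hn.norm_eq hcn (b j) hG
  have e2 := integral_eq_integral_slices hn'.norm_eq hcn' (b i) hG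
  rw [setIntegral_euclideanHausdorffMeasure hr (b j) (fun x hx => hn.inner_eq_zero h hx)
    (isCompact_simplexFace b i).measurableSet,
    setIntegral_euclideanHausdorffMeasure hr' (b i) (fun x hx => hn'.inner_eq_zero h.symm hx)
    (isCompact_simplexFace b j).measurableSet]
  simp only [hline] at e1 e2
  -- On the hyperplane of the face opposite to `b i`, `π` exchanges coordinates `i` and `j`, one of
  -- them being zero; hence it matches the two faces.
  have c1 : ∀ y : (ℝ ∙ n)ᗮ, (simplexFace b i).indicator (fun x => g (x + b.coord j x • v)) (b j + y) =
      (simplexFace b j).indicator g (π (b j + y)) := by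
    intro y
    have h0 := hn.coord_eq_zero h y
    generalize b j + (y : V) = x at h0
    have hmem : x ∈ simplexFace b i ↔ π x ∈ simplexFace b j := by
      constructor
      · intro hx
        refine ⟨by simp only [π, hv, coord_add_smul_edge_right b h, sub_self], fun k => ?_⟩
        simp only [π, hv]
        by_cases hki : k = i
        · subst hki; rw [coord_add_smul_edge_left b h, h0, zero_add]; exact hx.2 j
        by_cases hkj : k = j
        · subst hkj; rw [coord_add_smul_edge_right b h, sub_self]
        · rw [coord_add_smul_edge_of_ne b hki hkj]; exact hx.2 k
      · intro hx
        refine ⟨h0, fun k => ?_⟩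
        by_cases hki : k = i
        · subst hki; exact h0.ge
        by_cases hkj : k = j
        · subst hkj
          have := hx.2 i
          simp only [π, hv] at this
          rwa [coord_add_smul_edge_left b h, h0, zero_add] at this
        · have := hx.2 k
          simp only [π, hv] at this
          rwa [coord_add_smul_edge_of_ne b hki hkj] at this
    simp only [indicator_apply, hmem]
    rfl
  have c2 : ∀ y : (ℝ ∙ n')ᗮ, (simplexFace b j).indicator g (π (b i + y)) =
      (simplexFace b j).indicator g (b i + y) := by
    intro y
    have h0 := hn'.coord_eq_zero h.symm y
    simp only [π, h0, zero_smul, add_zero]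
  simp only [c1]
  simp only [c2] at e2
  rw [← e1, ← e2]

/-- Integration of an edge derivative over a simplex, along lines in the edge direction. -/
theorem setIntegral_simplex_edge_eq_shift {m : ℕ} (hm : finrank ℝ V = m + 1)
    (hn : IsOutwardNormal b i n) (h : i ≠ j) {f : V → ℝ} {f' : V → V →L[ℝ] ℝ}
    (hf : ∀ x, HasFDerivAt f (f' x) x) (hf' : Continuous f') :
    ∫ x in convexHull ℝ (range b), f' x (b i - b j) =
      |inner ℝ n (b i - b j)| * ∫ x in simplexFace b i,
        (f (x + b.coord j x • (b i - b j)) - f x) ∂(Measure.euclideanHausdorffMeasure m) := by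
  classical
  set v := b i - b j with hv
  have : Fact (finrank ℝ V = m + 1) := ⟨hm⟩
  have hcn : inner ℝ n v ≠ 0 := (hn.inner_edge_neg h).ne
  have hr : finrank ℝ (ℝ ∙ n)ᗮ = m :=
    Submodule.finrank_orthogonal_span_singleton (norm_ne_zero_iff.1 (by rw [hn.norm_eq]; norm_num))
  have hK : IsCompact (convexHull ℝ (range b)) := (Set.finite_range b).isCompact_convexHull (𝕜 := ℝ)
  have hfv : Continuous (fun x => f' x v) := by fun_prop
  rw [← integral_indicator hK.measurableSet,
    integral_eq_integral_slices hn.norm_eq hcn (b j)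
      ((hfv.continuousOn.integrableOn_compact hK).integrable_indicator hK.measurableSet),
    setIntegral_euclideanHausdorffMeasure hr (b j) (fun x hx => hn.inner_eq_zero h hx)
    (isCompact_simplexFace b i).measurableSet]
  congr 1
  apply integral_congr_ae
  refine Filter.Eventually.of_forall fun y => ?_
  have h0 := hn.coord_eq_zero h y
  simp only
  generalize b j + (y : V) = x at h0
  -- The line enters the simplex at `x` on the face opposite to `b i` and leaves when coordinate `j`
  -- is used up, at `s = b.coord j x`.
  have hmem : ∀ s : ℝ, x + s • v ∈ convexHull ℝ (range b) ↔
      x ∈ simplexFace b i ∧ s ∈ Icc 0 (b.coord j x) := by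
    intro s
    rw [b.convexHull_eq_nonneg_coord]
    constructor
    · intro hx
      have hi := hx i
      have hj := hx j
      rw [hv, coord_add_smul_edge_left b h, h0] at hi
      rw [hv, coord_add_smul_edge_right b h] at hj
      refine ⟨⟨h0, fun k => ?_⟩, by linarith, by linarith⟩
      by_cases hki : k = i
      · subst hki; exact h0.ge
      by_cases hkj : k = j
      · subst hkj; linarith
      · have := hx k
        rwa [hv, coord_add_smul_edge_of_ne b hki hkj] at this
    · rintro ⟨hx, hs⟩ k
      rw [hv]
      by_cases hki : k = i
      · subst hki; rw [coord_add_smul_edge_left b h, h0]; linarith [hs.1]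
      by_cases hkj : k = j
      · subst hkj; rw [coord_add_smul_edge_right b h]; linarith [hs.2]
      · rw [coord_add_smul_edge_of_ne b hki hkj]; exact hx.2 k
  by_cases hx : x ∈ simplexFace b i
  · have : ∀ s : ℝ, (convexHull ℝ (range b)).indicator (fun x => f' x v) (x + s • v) =
        (Icc 0 (b.coord j x)).indicator (fun s => f' (x + s • v) v) s := by
      intro s
      simp only [indicator_apply, hmem, hx, true_and]
    simp only [this]
    rw [integral_indicator measurableSet_Icc, integral_Icc_eq_integral_Ioc,
      ← intervalIntegral.integral_of_le (hx.2 j), indicator_of_mem hx]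
    have hd : ∀ s : ℝ, HasDerivAt (fun s : ℝ => f (x + s • v)) (f' (x + s • v) v) s := by
      intro s
      have h1 : HasDerivAt (fun s : ℝ => x + s • v) v s := by
        simpa using ((hasDerivAt_id s).smul_const v).const_add x
      exact (hf (x + s • v)).comp_hasDerivAt s h1
    rw [intervalIntegral.integral_eq_sub_of_hasDerivAt (fun s _ => hd s)]
    · simp
    · apply Continuous.intervalIntegrable
      fun_prop
  · have : ∀ s : ℝ, (convexHull ℝ (range b)).indicator (fun x => f' x v) (x + s • v) = 0 := by
      intro s
      simp only [indicator_apply, hmem, hx, false_and, if_false]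
    simp [this, hx]

theorem IsOutwardNormal.integrableOn_simplexFace {m : ℕ} (hm : finrank ℝ V = m + 1)
    (hn : IsOutwardNormal b i n) {g : V → ℝ} (hg : ContinuousOn g (simplexFace b i)) :
    IntegrableOn g (simplexFace b i) (Measure.euclideanHausdorffMeasure m) := by
  have : Fact (finrank ℝ V = m + 1) := ⟨hm⟩
  have : Nontrivial V := Module.nontrivial_of_finrank_pos (R := ℝ) (by omega)
  have : Nontrivial ι := by
    rw [← Fintype.one_lt_card_iff_nontrivial, b.card_eq_finrank_add_one]; omega
  obtain ⟨j, hj⟩ := exists_ne i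
  exact integrableOn_euclideanHausdorffMeasure
    (Submodule.finrank_orthogonal_span_singleton
      (norm_ne_zero_iff.1 (by rw [hn.norm_eq]; norm_num)))
    (b j) (fun x hx => hn.inner_eq_zero hj.symm hx) (isCompact_simplexFace b i) hg

/-- Integration of a directional derivative over a simplex. -/
theorem setIntegral_simplex_fderiv {m : ℕ} (hm : finrank ℝ V = m + 1) {ν : ι → V}
    (hν : ∀ i, IsOutwardNormal b i (ν i)) {f : V → ℝ} {f' : V → V →L[ℝ] ℝ}
    (hf : ∀ x, HasFDerivAt f (f' x) x) (hf' : Continuous f') (v : V) :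
    ∫ x in convexHull ℝ (range b), f' x v =
      ∑ i, inner ℝ (ν i) v * ∫ x in simplexFace b i, f x
        ∂(Measure.euclideanHausdorffMeasure m) := by
  classical
  have hfc : Continuous f := continuous_iff_continuousAt.2 fun x => (hf x).continuousAt
  have hK : IsCompact (convexHull ℝ (range b)) := (Set.finite_range b).isCompact_convexHull (𝕜 := ℝ)
  -- Every face other than those opposite to `b i` and `b j` contains this edge, so its normal
  -- contributes nothing.
  have hedge : ∀ i j, i ≠ j → ∫ x in convexHull ℝ (range b), f' x (b i - b j) =
      ∑ l, inner ℝ (ν l) (b i - b j) * ∫ x in simplexFace b l, f x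
        ∂(Measure.euclideanHausdorffMeasure m) := by
    intro i j hij
    have hc := continuous_barycentric_coord b j
    rw [setIntegral_simplex_edge_eq_shift hm (hν i) hij hf hf', integral_sub, mul_sub,
      setIntegral_simplexFace_shift hm (hν i) (hν j) hij hfc,
      ← Finset.sum_subset (Finset.subset_univ {i, j}), Finset.sum_pair hij,
      abs_of_neg ((hν i).inner_edge_neg hij), abs_of_pos]
    · ring
    · rw [← neg_sub, inner_neg_right]; exact neg_pos.2 ((hν j).inner_edge_neg hij.symm)
    · intro l _ hl
      simp only [Finset.mem_insert, Finset.mem_singleton, not_or] at hl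
      rw [(hν l).inner_sub hl.2, b.coord_apply_ne hl.1, zero_mul, zero_mul]
    · exact (hν i).integrableOn_simplexFace hm (by fun_prop)
    · exact (hν i).integrableOn_simplexFace hm (by fun_prop)
  obtain ⟨j⟩ := b.nonempty
  -- Edges issuing from one vertex span the space, so the general direction follows by linearity.
  have hv : v = ∑ k, b.coord k (b j + v) • (b k - b j) := by
    rw [← sub_eq_sum_coord_smul, add_sub_cancel_left]
  have hedge' : ∀ k, ∫ x in convexHull ℝ (range b), f' x (b k - b j) =
      ∑ l, inner ℝ (ν l) (b k - b j) * ∫ x in simplexFace b l, f x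
        ∂(Measure.euclideanHausdorffMeasure m) := by
    intro k
    by_cases hkj : k = j
    · subst hkj; simp
    · exact hedge k j hkj
  obtain ⟨w, hv⟩ : ∃ w : ι → ℝ, v = ∑ k, w k • (b k - b j) := ⟨_, hv⟩
  simp only [hv, map_sum, map_smul, smul_eq_mul, inner_sum, inner_smul_right, Finset.sum_mul]
  rw [integral_finsetSum, Finset.sum_comm]
  · refine Finset.sum_congr rfl fun k _ => ?_
    rw [integral_const_mul, hedge' k, Finset.mul_sum]
    exact Finset.sum_congr rfl fun l _ => by ring
  · intro k _
    have : Continuous (fun x => w k * f' x (b k - b j)) := by fun_prop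
    exact this.continuousOn.integrableOn_compact hK

end SimplexDivergence

/-! ### Faces of a simplex as convex hulls of vertices -/

section SimplexFaces

variable {ι V : Type*} [NormedAddCommGroup V] [InnerProductSpace ℝ V]

theorem convex_simplexFace (b : AffineBasis ι ℝ V) (i : ι) : Convex ℝ (simplexFace b i) := by
  rw [simplexFace, ofPred_and, ofPred_forall]
  exact ((convex_singleton (0 : ℝ)).affine_preimage (b.coord i)).inter
    (convex_iInter fun j => (convex_Ici (0 : ℝ)).affine_preimage (b.coord j))

theorem simplexFace_eq_convexHull [Fintype ι] (b : AffineBasis ι ℝ V) (i : ι) :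
    simplexFace b i = convexHull ℝ (b '' {i}ᶜ) := by
  classical
  apply Subset.antisymm
  · intro x hx
    have hs : ∑ k ∈ Finset.univ.erase i, b.coord k x • b k = x := by
      rw [← b.linear_combination_coord_eq_self x, ← Finset.add_sum_erase _ _ (Finset.mem_univ i)]
      simp [b.linear_combination_coord_eq_self x, hx.1]
    have h1 : ∑ k ∈ Finset.univ.erase i, b.coord k x = 1 := by
      rw [← b.sum_coord_apply_eq_one x, ← Finset.add_sum_erase _ _ (Finset.mem_univ i), hx.1,
        zero_add]
    rw [← hs]
    refine (convex_convexHull ℝ _).sum_mem (fun k _ => hx.2 k) h1 fun k hk => ?_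
    exact subset_convexHull ℝ _ ⟨k, by simpa using hk, rfl⟩
  · refine convexHull_min ?_ (convex_simplexFace b i)
    rintro _ ⟨k, hk, rfl⟩
    exact mem_simplexFace_of_ne b (Ne.symm hk)

end SimplexFaces

/-! ### Derivatives of polynomial functions -/

section Polynomials

variable {d : ℕ}

/-- The derivative of a polynomial function on `ℝ^d`. -/
def evalFDeriv (p : MvPolynomial (Fin d) ℝ) (x : E d) : E d →L[ℝ] ℝ :=
  ∑ j, MvPolynomial.eval (fun i => x i) (MvPolynomial.pderiv j p) •
    (EuclideanSpace.proj j : E d →L[ℝ] ℝ)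

theorem evalFDeriv_apply (p : MvPolynomial (Fin d) ℝ) (x v : E d) :
    evalFDeriv p x v = ∑ j, MvPolynomial.eval (fun i => x i) (MvPolynomial.pderiv j p) * v j := by
  simp [evalFDeriv]

theorem continuous_eval (p : MvPolynomial (Fin d) ℝ) :
    Continuous (fun x : E d => MvPolynomial.eval (fun i => x i) p) :=
  (MvPolynomial.continuous_eval p).comp (by fun_prop)

theorem continuous_evalFDeriv (p : MvPolynomial (Fin d) ℝ) : Continuous (evalFDeriv p) :=
  continuous_finsetSum _ fun _ _ => (continuous_eval _).smul continuous_const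

theorem hasFDerivAt_eval (p : MvPolynomial (Fin d) ℝ) (x : E d) :
    HasFDerivAt (fun x : E d => MvPolynomial.eval (fun i => x i) p) (evalFDeriv p x) x := by
  induction p using MvPolynomial.induction_on with
  | C a =>
    have : evalFDeriv (MvPolynomial.C a) x = 0 := by ext v; simp [evalFDeriv_apply]
    rw [this]
    simpa using hasFDerivAt_const a x
  | add p q hp hq =>
    have : evalFDeriv (p + q) x = evalFDeriv p x + evalFDeriv q x := by
      ext v; simp [evalFDeriv_apply, add_mul, Finset.sum_add_distrib]
    rw [this]
    simp only [map_add]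
    exact hp.add hq
  | mul_X p k hp =>
    have hX : HasFDerivAt (fun x : E d => x k) (EuclideanSpace.proj k : E d →L[ℝ] ℝ) x :=
      (EuclideanSpace.proj k : E d →L[ℝ] ℝ).hasFDerivAt
    have := hp.mul hX
    have e : evalFDeriv (p * MvPolynomial.X k) x =
        MvPolynomial.eval (fun i => x i) p • (EuclideanSpace.proj k : E d →L[ℝ] ℝ) +
          x k • evalFDeriv p x := by
      ext v
      simp only [evalFDeriv_apply, Derivation.leibniz, smul_eq_mul, map_add, map_mul,
        MvPolynomial.eval_X, MvPolynomial.pderiv_X, add_mul, Finset.sum_add_distrib,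
        add_apply, smul_apply, Finset.mul_sum]
      congr 1
      · rw [Finset.sum_eq_single k]
        · simp
        · intro j _ hj; simp [hj.symm]
        · simp
      · exact Finset.sum_congr rfl fun j _ => by ring
    rw [e]
    simp only [map_mul, MvPolynomial.eval_X]
    exact this

end Polynomials

/-! ### Elements and their facets -/

namespace Mesh

variable {d : ℕ} {Ω : Set (E d)} {M : Mesh d Ω}

theorem continuous_sval (q : M.BrokenScalar) (K : M.Cell) : Continuous (sval q K) :=
  continuous_eval (q K)

theorem continuous_vval (v : M.BrokenVector) (K : M.Cell) : Continuous (vval v K) :=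
  (PiLp.continuous_toLp 2 _).comp (continuous_pi fun i => continuous_eval (v K i))

/-- The vertices of an element as an affine basis of `ℝ^d`. -/
def cellBasis (K : M.Cell) : AffineBasis K.1 ℝ (E d) where
  toFun := (↑)
  ind' := M.complex.indep K.2.1
  tot' := by
    rw [(M.complex.indep K.2.1).affineSpan_eq_top_iff_card_eq_finrank_add_one]
    simp [K.2.2]

theorem range_cellBasis (K : M.Cell) : range (cellBasis K) = (K.1 : Set (E d)) :=
  Subtype.range_coe

theorem simplexFace_cellBasis (K : M.Cell) (a : K.1) :
    simplexFace (cellBasis K) a = convexHull ℝ ((K.1.erase a : Finset (E d)) : Set (E d)) := by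
  rw [simplexFace_eq_convexHull]
  congr 1
  ext x
  simp only [mem_image, mem_compl_iff, mem_singleton_iff, Finset.coe_erase, mem_sdiff,
    Finset.mem_coe]
  constructor
  · rintro ⟨k, hk, rfl⟩
    exact ⟨k.2, fun h => hk (Subtype.ext h)⟩
  · rintro ⟨hx, hne⟩
    exact ⟨⟨x, hx⟩, fun h => hne (congrArg Subtype.val h), rfl⟩

theorem isCompact_cellSet (K : M.Cell) : IsCompact (M.cellSet K) :=
  K.1.finite_toSet.isCompact_convexHull (𝕜 := ℝ)

/-- The facet of an element opposite to a vertex. -/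
def oppositeFacet (hd : 0 < d) (K : M.Cell) (a : K.1) : M.Facet :=
  ⟨K.1.erase a, by
    have hc : (K.1.erase (a : E d)).card = d := by
      rw [Finset.card_erase_of_mem a.2, K.2.2, Nat.add_sub_cancel]
    exact ⟨M.complex.down_closed K.2.1 (Finset.erase_subset _ _)
      (Finset.card_pos.1 (by rw [hc]; exact hd)), hc⟩⟩

theorem exists_eq_oppositeFacet (hd : 0 < d) {K : M.Cell} {F : M.Facet} (h : F.1 ⊆ K.1) :
    ∃ a : K.1, oppositeFacet hd K a = F := by
  have hc : (K.1 \ F.1).card = 1 := by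
    rw [Finset.card_sdiff_of_subset h, K.2.2, F.2.2, Nat.add_sub_cancel_left]
  obtain ⟨a, ha⟩ := Finset.card_eq_one.1 hc
  have haK : a ∈ K.1 := (Finset.mem_sdiff.1 (ha ▸ Finset.mem_singleton_self a)).1
  refine ⟨⟨a, haK⟩, Subtype.ext ?_⟩
  change K.1.erase a = F.1
  rw [← Finset.sdiff_singleton_eq_erase, ← ha, Finset.sdiff_sdiff_eq_self h]

theorem oppositeFacet_subset (hd : 0 < d) (K : M.Cell) (a : K.1) :
    (oppositeFacet hd K a).1 ⊆ K.1 := Finset.erase_subset _ _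

theorem oppositeFacet_injective (hd : 0 < d) (K : M.Cell) :
    Function.Injective (oppositeFacet (M := M) hd K) := by
  intro a a' h
  have h1 : K.1.erase (a : E d) = K.1.erase (a' : E d) := congrArg Subtype.val h
  exact Subtype.ext (Finset.erase_injOn K.1 a.2 a'.2 h1)

end Mesh

/-! ### The divergence theorem on the mesh -/

namespace OrientedMesh

open Mesh

variable {d : ℕ} {Ω : Set (E d)} {M : OrientedMesh d Ω}

open Classical in
/-- The normal of the facet `F`, pointing out of the element `K`. -/
def outward (M : OrientedMesh d Ω) (K : M.toMesh.Cell) (F : M.Facet) : E d :=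
  if K = M.plus F then M.normal F else -M.normal F

/-- By `subset_iff`, an element containing the facet and different from `plus` must be `minus`; the
facet is then interior and the fixed normal points into the element, whence the sign change. -/
theorem isOutwardNormal_outward (hd : 0 < d) (K : M.toMesh.Cell) (a : K.1) :
    IsOutwardNormal (cellBasis K) a (M.outward K (oppositeFacet hd K a)) := by
  have hF := (M.subset_iff (oppositeFacet hd K a) K).1 (oppositeFacet_subset hd K a)
  have hface : simplexFace (cellBasis K) a = M.toMesh.facetSet (oppositeFacet hd K a) :=
    simplexFace_cellBasis K a
  have hcell : convexHull ℝ (range (cellBasis K)) = M.toMesh.cellSet K := by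
    rw [range_cellBasis]; rfl
  generalize oppositeFacet hd K a = F at hF hface
  constructor
  · unfold outward; split_ifs <;> simp [M.norm_normal]
  · intro x hx y hy
    rw [hface] at hx
    rw [hcell] at hy
    unfold outward
    split_ifs with h
    · subst h; exact M.normal_plus F x hx y hy
    · have h' := hF.resolve_left h
      subst h'
      rw [inner_neg_left, neg_nonpos]
      exact M.normal_minus F (Ne.symm h) x hx y hy

theorem subset_plus (F : M.Facet) : F.1 ⊆ (M.plus F).1 := (M.subset_iff F _).2 (Or.inl rfl)

theorem integrableOn_facetSet (hd : 0 < d) (F : M.Facet) {g : E d → ℝ} (hg : Continuous g) :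
    IntegrableOn g (M.toMesh.facetSet F) (Measure.euclideanHausdorffMeasure (d - 1)) := by
  obtain ⟨a, ha⟩ := exists_eq_oppositeFacet hd (subset_plus F)
  have hn := isOutwardNormal_outward hd (M.plus F) a
  have := hn.integrableOn_simplexFace (m := d - 1) (by simp; omega) hg.continuousOn
  rw [simplexFace_cellBasis] at this
  rw [← ha]; exact this

/-- The divergence theorem for polynomial vector fields on an element. -/
theorem setIntegral_cellSet_div (hd : 0 < d) (w : M.BrokenVector) (K : M.toMesh.Cell) :
    ∫ x in M.toMesh.cellSet K, sval (div w) K x =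
      ∑ F : M.Facet, open Classical in if F.1 ⊆ K.1 then
        M.facetIntegral F (fun x => inner ℝ (vval w K x) (M.outward K F)) else 0 := by
  classical
  have hcell : convexHull ℝ (range (cellBasis K)) = M.toMesh.cellSet K := by
    rw [range_cellBasis]; rfl
  have hdiv : ∀ x, sval (div w) K x =
      ∑ i, evalFDeriv (w K i) x (EuclideanSpace.single i (1 : ℝ)) := by
    intro x
    simp [sval, div, evalFDeriv_apply, map_sum]
  have hi : ∀ i, ∫ x in M.toMesh.cellSet K, evalFDeriv (w K i) x (EuclideanSpace.single i (1 : ℝ)) =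
      ∑ a : K.1, M.facetIntegral (oppositeFacet hd K a)
        (fun x => M.outward K (oppositeFacet hd K a) i * vval w K x i) := by
    intro i
    rw [← hcell, setIntegral_simplex_fderiv (m := d - 1) (by simp; omega)
      (isOutwardNormal_outward hd K) (hasFDerivAt_eval (w K i)) (continuous_evalFDeriv (w K i))]
    refine Finset.sum_congr rfl fun a _ => ?_
    rw [facetIntegral, integral_const_mul, simplexFace_cellBasis]
    congr 1
    exact (EuclideanSpace.inner_single_right i (1 : ℝ) _).trans (by simp)
  simp only [hdiv]
  rw [integral_finsetSum]
  swap
  · intro i _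
    have : Continuous fun x => evalFDeriv (w K i) x (EuclideanSpace.single i (1 : ℝ)) :=
      (continuous_evalFDeriv (w K i)).clm_apply continuous_const
    exact this.continuousOn.integrableOn_compact (isCompact_cellSet K)
  simp only [hi]
  rw [Finset.sum_comm, ← Finset.sum_filter]
  symm
  -- Facets contained in the element correspond to its vertices, each facet to the vertex it omits.
  refine Finset.sum_bij' (i := fun F hF =>
      (exists_eq_oppositeFacet hd (Finset.mem_filter.1 hF).2).choose)
    (j := fun a _ => oppositeFacet hd K a) ?_ ?_ ?_ ?_ ?_
  · intros; exact Finset.mem_univ _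
  · intro a _
    exact Finset.mem_filter.2 ⟨Finset.mem_univ _, oppositeFacet_subset hd K a⟩
  · intro F hF
    exact (exists_eq_oppositeFacet hd (Finset.mem_filter.1 hF).2).choose_spec
  · intro a ha
    exact oppositeFacet_injective hd K
      (exists_eq_oppositeFacet hd (oppositeFacet_subset hd K a)).choose_spec
  · intro F hF
    have hs := (exists_eq_oppositeFacet hd (Finset.mem_filter.1 hF).2).choose_spec
    rw [hs]
    simp only [facetIntegral]
    rw [← integral_finsetSum]
    · simp [PiLp.inner_apply]
    · intro i _
      refine integrableOn_facetSet hd F (continuous_const.mul ?_)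
      exact (EuclideanSpace.proj i : E d →L[ℝ] ℝ).continuous.comp (continuous_vval w K)

/-- Exchanging the sums collects, on an interior facet, two traces with opposite normals, which is
the normal jump; a boundary facet is met once. -/
theorem sum_setIntegral_div (hd : 0 < d) (w : M.BrokenVector) :
    ∑ K : M.toMesh.Cell, ∫ x in M.toMesh.cellSet K, sval (div w) K x =
      ∑ F : M.Facet, M.facetIntegral F (jumpN w F) := by
  classical
  simp only [setIntegral_cellSet_div hd]
  rw [Finset.sum_comm]
  refine Finset.sum_congr rfl fun F _ => ?_
  have hK : ∀ K : M.toMesh.Cell, (F.1 ⊆ K.1) ↔ K ∈ ({M.plus F, M.minus F} : Finset _) := by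
    intro K
    rw [M.subset_iff, Finset.mem_insert, Finset.mem_singleton]
  simp only [hK]
  rw [← Finset.sum_filter, Finset.filter_mem_eq_inter, Finset.univ_inter]
  by_cases hF : M.plus F = M.minus F
  · have : ¬ M.IsInterior F := fun h => h hF
    rw [← hF, Finset.pair_eq_singleton, Finset.sum_singleton]
    unfold jumpN
    simp [jump, this, outward]
  · have : M.IsInterior F := hF
    rw [Finset.sum_pair hF]
    simp only [facetIntegral, outward, if_true, if_neg (Ne.symm hF)]
    rw [← integral_add]
    · congr 1
      ext x
      simp only [jumpN, jump, this, if_true, inner_sub_left, inner_neg_right]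
      ring
    · exact integrableOn_facetSet hd F ((continuous_vval w _).inner continuous_const)
    · exact integrableOn_facetSet hd F ((continuous_vval w _).inner continuous_const)

end OrientedMesh

/-! ### The divergence of the energy flux -/

namespace Mesh

variable {d : ℕ} {Ω : Set (E d)} {M : Mesh d Ω}

theorem sval_dot (v w : M.BrokenVector) (K : M.Cell) (x : E d) :
    sval (dot v w) K x = inner ℝ (vval v K x) (vval w K x) := by
  simp [sval, dot, vval, PiLp.inner_apply, mul_comm]

/-- Product rule: `u · ∇|u|² = 2 (u · ∇u) · u`, and the remaining term is `|u|² div u`. -/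
theorem sval_div_smulField_dot_self (u : M.BrokenVector) (K : M.Cell) (x : E d) :
    sval (div (smulField (dot u u) u)) K x =
      2 * inner ℝ (vval (conv u u) K x) (vval u K x) +
        inner ℝ (vval (smulField (div u) u) K x) (vval u K x) := by
  simp only [sval, div, smulField, dot, conv, vval, PiLp.inner_apply, Derivation.leibniz, map_sum,
    smul_eq_mul, map_add, map_mul, RCLike.inner_apply, conj_trivial]
  rw [Finset.sum_add_distrib, add_comm]
  congr 1
  · simp only [Finset.mul_sum]
    rw [Finset.sum_comm]
    exact Finset.sum_congr rfl fun i _ => Finset.sum_congr rfl fun j _ => by ring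
  · simp only [Finset.mul_sum, Finset.sum_mul]
    rw [Finset.sum_comm]
    exact Finset.sum_congr rfl fun i _ => Finset.sum_congr rfl fun j _ => by ring

theorem integrableOn_inner (v w : M.BrokenVector) (K : M.Cell) :
    IntegrableOn (fun x => inner ℝ (vval v K x) (vval w K x)) (M.cellSet K) :=
  ((continuous_vval v K).inner (continuous_vval w K)).continuousOn.integrableOn_compact
    (isCompact_cellSet K)

theorem sum_setIntegral_div_smulField_dot_self (u : M.BrokenVector) :
    ∑ K : M.Cell, ∫ x in M.cellSet K, sval (div (smulField (dot u u) u)) K x =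
      2 * ipV (conv u u) u + ipV (smulField (div u) u) u := by
  simp only [ipV, Finset.mul_sum, ← Finset.sum_add_distrib]
  refine Finset.sum_congr rfl fun K _ => ?_
  simp only [sval_div_smulField_dot_self]
  rw [integral_add ((integrableOn_inner _ _ K).const_mul 2) (integrableOn_inner _ _ K),
    integral_const_mul]

end Mesh

/-! ### Energy balance and sign of the convective forms -/

namespace OrientedMesh

open Mesh

variable {d : ℕ} {Ω : Set (E d)} {M : OrientedMesh d Ω}

theorem continuous_jump {V : Type} [AddCommGroup V] [TopologicalSpace V] [IsTopologicalAddGroup V]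
    {f : M.toMesh.Cell → E d → V} (hf : ∀ K, Continuous (f K)) (F : M.Facet) :
    Continuous (M.jump f F) := by
  by_cases h : M.IsInterior F
  · unfold jump
    simp only [h, if_true]
    exact (hf _).sub (hf _)
  · unfold jump
    simp only [h, if_false]
    exact hf _

theorem continuous_avg {V : Type} [AddCommGroup V] [Module ℝ V] [TopologicalSpace V]
    [IsTopologicalAddGroup V] [ContinuousSMul ℝ V] {f : M.toMesh.Cell → E d → V}
    (hf : ∀ K, Continuous (f K)) (F : M.Facet) : Continuous (M.avg f F) := by
  by_cases h : M.IsInterior F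
  · unfold avg
    simp only [h, if_true]
    exact ((hf _).add (hf _)).const_smul (1 / 2 : ℝ)
  · unfold avg
    simp only [h, if_false]
    exact hf _

theorem continuous_jumpN (v : M.BrokenVector) (F : M.Facet) : Continuous (jumpN v F) :=
  (continuous_jump (continuous_vval v) F).inner continuous_const

theorem continuous_avgN (v : M.BrokenVector) (F : M.Facet) : Continuous (avgN v F) :=
  (continuous_avg (continuous_vval v) F).inner continuous_const

open Classical in
/-- The energy flux through the boundary faces. -/
def boundaryFlux (u : M.BrokenVector) : ℝ :=
  ∑ F : M.Facet, if M.IsInterior F then 0 else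
    M.facetIntegral F (fun x => jumpN u F x * sval (dot u u) (M.plus F) x)

/-- The product rule for jumps, applied to the energy flux. -/
theorem jumpN_energyFlux (u : M.BrokenVector) {F : M.Facet} (h : M.IsInterior F) (x : E d) :
    jumpN (smulField (dot u u) u) F x =
      2 * (avgN u F x * inner ℝ (M.jump (vval u) F x) (M.avg (vval u) F x)) +
        jumpN u F x * M.avg (sval (dot u u)) F x := by
  have hs : ∀ K, vval (smulField (dot u u) u) K x = sval (dot u u) K x • vval u K x := by
    intro K
    ext i
    simp [vval, smulField, sval]
  simp only [jumpN, avgN, jump, avg, h, if_true, hs, sval_dot]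
  generalize vval u (M.plus F) x = p
  generalize vval u (M.minus F) x = q
  simp only [inner_sub_left, inner_smul_left, inner_add_left, inner_add_right, inner_smul_right,
    smul_eq_mul, conj_trivial, real_inner_comm q p]
  ring

theorem sum_facetIntegral_energyFlux (hd : 0 < d) (u : M.BrokenVector) :
    ∑ F : M.Facet, M.facetIntegral F (jumpN (smulField (dot u u) u) F) =
      2 * M.sumInt (fun F x => avgN u F x * inner ℝ (M.jump (vval u) F x) (M.avg (vval u) F x)) +
        M.sumInt (fun F x => jumpN u F x * M.avg (sval (dot u u)) F x) + boundaryFlux u := by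
  classical
  simp only [sumInt, boundaryFlux, Finset.mul_sum, ← Finset.sum_add_distrib]
  refine Finset.sum_congr rfl fun F _ => ?_
  by_cases h : M.IsInterior F
  · simp only [h, if_true, add_zero, facetIntegral, jumpN_energyFlux u h]
    rw [integral_add, integral_const_mul]
    · refine integrableOn_facetSet hd F (continuous_const.mul ((continuous_avgN u F).mul ?_))
      exact (continuous_jump (continuous_vval u) F).inner (continuous_avg (continuous_vval u) F)
    · exact integrableOn_facetSet hd F
        ((continuous_jumpN u F).mul (continuous_avg (continuous_sval _) F))
  · simp only [h, if_false, mul_zero, zero_add, facetIntegral]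
    congr 1
    ext x
    have hs : vval (smulField (dot u u) u) (M.plus F) x =
        sval (dot u u) (M.plus F) x • vval u (M.plus F) x := by
      ext i
      simp [vval, smulField, sval]
    simp only [jumpN, jump, h, if_false, hs, inner_smul_left, conj_trivial, mul_comm]

/-- The energy balance of the convective form. -/
theorem c1_self (hd : 0 < d) (θ : ℝ) (ζ : M.Facet → ℝ) (u : M.BrokenVector) :
    c1 θ ζ u u = (1 - θ) / 2 * boundaryFlux u +
      M.sumAll (fun F x => ζ F * |avgN u F x| *
        inner ℝ (M.jump (vval u) F x) (M.jump (vval u) F x)) := by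
  have h := sum_facetIntegral_energyFlux hd u
  rw [← sum_setIntegral_div hd, sum_setIntegral_div_smulField_dot_self] at h
  unfold c1
  -- At `v = u` each `θ` term is `-θ` times one of the other volume or interior-face terms.
  linear_combination (1 - θ) / 2 * h

/-- The forms differ only in whether `u` or `v` supplies the divergence and the normal jump in the
`θ / 2` terms. -/
theorem c2_self (θ : ℝ) (ζ : M.Facet → ℝ) (u : M.BrokenVector) :
    c2 θ ζ u u = c1 θ ζ u u := by
  unfold c1 c2
  ring

theorem upwind_nonneg {ζ : M.Facet → ℝ} (hζ : ∀ F, 0 ≤ ζ F) (u : M.BrokenVector) (F : M.Facet) :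
    0 ≤ M.facetIntegral F (fun x => ζ F * |avgN u F x| *
      inner ℝ (M.jump (vval u) F x) (M.jump (vval u) F x)) :=
  integral_nonneg fun _ => mul_nonneg (mul_nonneg (hζ F) (abs_nonneg _)) real_inner_self_nonneg

/-- On a boundary facet flux and upwind term combine to `((1 - θ) / 2 * m + ζ |m|) |u|²` with `m = u
· n`, and the bound on `ζ` makes the bracket non-negative. -/
theorem c1_self_nonneg_of_boundary (hd : 0 < d) {θ : ℝ} {ζ : M.Facet → ℝ} (hζ : ∀ F, 0 ≤ ζ F)
    (hb : ∀ F, M.IsBoundary F → 1 / 2 * |1 - θ| ≤ ζ F) (u : M.BrokenVector) :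
    0 ≤ c1 θ ζ u u := by
  classical
  rw [c1_self hd, boundaryFlux, sumAll, Finset.mul_sum, ← Finset.sum_add_distrib]
  refine Finset.sum_nonneg fun F _ => ?_
  by_cases h : M.IsInterior F
  · simp only [h, if_true, mul_zero, zero_add]
    exact upwind_nonneg hζ u F
  · simp only [h, if_false]
    simp only [facetIntegral]
    rw [← integral_const_mul, ← integral_add]
    · refine integral_nonneg fun x => ?_
      simp only [jumpN, avgN, jump, avg, h, if_false, sval_dot]
      have h1 := hb F (not_not.1 h)
      set m := inner ℝ (vval u (M.plus F) x) (M.normal F)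
      have h2 : 0 ≤ inner ℝ (vval u (M.plus F) x) (vval u (M.plus F) x) := real_inner_self_nonneg
      set r := inner ℝ (vval u (M.plus F) x) (vval u (M.plus F) x)
      have h3 : |(1 - θ) / 2 * m| ≤ ζ F * |m| := by
        rw [abs_mul, abs_div, abs_two]
        exact mul_le_mul_of_nonneg_right (by linarith) (abs_nonneg m)
      have h4 : 0 ≤ (1 - θ) / 2 * m + ζ F * |m| := by linarith [neg_abs_le ((1 - θ) / 2 * m)]
      have := mul_nonneg h4 h2
      change 0 ≤ (1 - θ) / 2 * (m * r) + ζ F * |m| * r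
      linarith
    · exact integrableOn_facetSet hd F
        (continuous_const.mul ((continuous_jumpN u F).mul (continuous_sval _ _)))
    · exact integrableOn_facetSet hd F ((continuous_const.mul (continuous_avgN u F).abs).mul
        ((continuous_jump (continuous_vval u) F).inner (continuous_jump (continuous_vval u) F)))

theorem c1_self_nonneg_of_normal_eq_zero (hd : 0 < d) {θ : ℝ} {ζ : M.Facet → ℝ}
    (hζ : ∀ F, 0 ≤ ζ F) {u : M.BrokenVector}
    (hu : ∀ F, M.IsBoundary F → ∀ x ∈ M.toMesh.facetSet F,
      inner ℝ (vval u (M.plus F) x) (M.normal F) = 0) :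
    0 ≤ c1 θ ζ u u := by
  classical
  have h0 : boundaryFlux u = 0 := by
    refine Finset.sum_eq_zero fun F _ => ?_
    by_cases h : M.IsInterior F
    · simp [h]
    · simp only [h, if_false]
      refine setIntegral_eq_zero_of_forall_eq_zero fun x hx => ?_
      simp only [jumpN, jump, h, if_false]
      rw [hu F (not_not.1 h) x hx, zero_mul]
  rw [c1_self hd, h0, mul_zero, zero_add]
  exact Finset.sum_nonneg fun F _ => upwind_nonneg hζ u F

theorem pen_self_nonneg {γ : ℝ} (hγ : 0 ≤ γ) (u : M.BrokenVector) : 0 ≤ pen γ u u := by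
  refine mul_nonneg hγ (add_nonneg ?_ ?_)
  · exact Finset.sum_nonneg fun F _ => mul_nonneg (inv_nonneg.2 Metric.diam_nonneg)
      (integral_nonneg fun x => mul_self_nonneg _)
  · exact Finset.sum_nonneg fun K _ => integral_nonneg fun x => mul_self_nonneg _

end OrientedMesh

/-! ### The `L²` norm as a quadratic form in the coefficients -/

namespace Mesh

variable {d : ℕ} {Ω : Set (E d)} {M : Mesh d Ω}

theorem interior_cellSet_subset (K : M.Cell) : interior (M.cellSet K) ⊆ Ω :=
  (interior_mono ((M.complex.convexHull_subset_space K.2.1).trans M.space_eq.subset)).trans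
    M.interior_closure.subset

/-- Two elements meet in the hull of their common vertices. If that hull has interior points it
needs `d + 1` vertices, which forces the elements to coincide. -/
theorem disjoint_interior_cellSet {K K' : M.Cell} (h : K ≠ K') :
    Disjoint (interior (M.cellSet K)) (interior (M.cellSet K')) := by
  classical
  rw [Set.disjoint_iff]
  rintro x hx
  rw [← interior_inter] at hx
  have hx' : x ∈ interior (convexHull ℝ ((K.1 ∩ K'.1 : Finset (E d)) : Set (E d))) := by
    rw [Finset.coe_inter]
    exact interior_mono (M.complex.inter_subset_convexHull K.2.1 K'.2.1) hx
  have htop := interior_convexHull_nonempty_iff_affineSpan_eq_top.1 ⟨x, hx'⟩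
  have hind : AffineIndependent ℝ ((↑) : (K.1 ∩ K'.1 : Finset (E d)) → E d) :=
    AffineIndependent.mono (s := ((K.1 ∩ K'.1 : Finset (E d)) : Set (E d)))
      (M.complex.indep K.2.1) (by simp)
  have hc : (K.1 ∩ K'.1).card = d + 1 := by
    have h1 := hind.affineSpan_eq_top_iff_card_eq_finrank_add_one
    have h2 : range ((↑) : (K.1 ∩ K'.1 : Finset (E d)) → E d) =
        ((K.1 ∩ K'.1 : Finset (E d)) : Set (E d)) := Subtype.range_coe
    rw [h2] at h1
    simpa using h1.1 htop
  have e1 := Finset.eq_of_subset_of_card_le (Finset.inter_subset_left (s₁ := K.1) (s₂ := K'.1))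
    (by rw [hc, K.2.2])
  have e2 := Finset.eq_of_subset_of_card_le (Finset.inter_subset_right (s₁ := K.1) (s₂ := K'.1))
    (by rw [hc, K'.2.2])
  exact h (Subtype.ext (e1.symm.trans e2))

theorem enorm_toFun_sq (v : M.BrokenVector) (x : E d) :
    ‖toFun v x‖ₑ ^ 2 =
      ∑ K : M.Cell, (interior (M.cellSet K)).indicator (fun x => ‖vval v K x‖ₑ ^ 2) x := by
  classical
  by_cases hx : ∃ K : M.Cell, x ∈ interior (M.cellSet K)
  · obtain ⟨K, hK⟩ := hx
    have hne : ∀ K', K' ≠ K → x ∉ interior (M.cellSet K') := fun K' h hx' =>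
      Set.disjoint_left.1 (disjoint_interior_cellSet h) hx' hK
    rw [toFun, Finset.sum_eq_single K (fun K' _ h => indicator_of_notMem (hne K' h) _) (by simp),
      Finset.sum_eq_single K (fun K' _ h => indicator_of_notMem (hne K' h) _) (by simp),
      indicator_of_mem hK, indicator_of_mem hK]
  · push Not at hx
    simp [toFun, indicator_of_notMem (hx _)]

theorem lintegral_enorm_toFun_sq (v : M.BrokenVector) :
    ∫⁻ x in Ω, ‖toFun v x‖ₑ ^ 2 = ENNReal.ofReal (ipV v v) := by
  have hmeas : ∀ K : M.Cell, Measurable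
      ((interior (M.cellSet K)).indicator (fun x => ‖vval v K x‖ₑ ^ 2)) := fun K =>
    ((continuous_vval v K).enorm.measurable.pow_const 2).indicator isOpen_interior.measurableSet
  simp only [enorm_toFun_sq]
  rw [lintegral_finsetSum _ fun K _ => hmeas K, ipV, ENNReal.ofReal_sum_of_nonneg]
  swap
  · exact fun K _ => integral_nonneg fun x => real_inner_self_nonneg
  refine Finset.sum_congr rfl fun K _ => ?_
  -- The boundary of a convex set is null, so dropping it in `toFun` does not change the integral.
  have hfr : volume (frontier (M.cellSet K)) = 0 :=
    (convex_convexHull ℝ (K.1 : Set (E d))).addHaar_frontier volume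
  rw [lintegral_indicator isOpen_interior.measurableSet,
    Measure.restrict_restrict isOpen_interior.measurableSet,
    inter_eq_left.2 (interior_cellSet_subset K),
    setLIntegral_congr (interior_ae_eq_of_null_frontier hfr),
    ofReal_integral_eq_lintegral_ofReal (integrableOn_inner v v K)
      (Filter.Eventually.of_forall fun x => real_inner_self_nonneg)]
  refine lintegral_congr fun x => ?_
  rw [real_inner_self_eq_norm_sq, ENNReal.ofReal_pow (norm_nonneg _), ofReal_norm]

theorem normL2_eq (v : M.BrokenVector) :
    normL2 v = ENNReal.ofReal (ipV v v) ^ (1 / 2 : ℝ) := by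
  rw [normL2, eLpNorm_eq_lintegral_rpow_enorm_toReal (by norm_num) (by norm_num),
    ← lintegral_enorm_toFun_sq]
  simp

theorem normL2_le_of_ipV_le {v w : M.BrokenVector} (h : ipV v v ≤ ipV w w) :
    normL2 v ≤ normL2 w := by
  rw [normL2_eq, normL2_eq]
  exact ENNReal.rpow_le_rpow (ENNReal.ofReal_le_ofReal h) (by norm_num)

/-- The integral over an element of the product of two monomials. -/
def massEntry (K : M.Cell) (m m' : Fin d →₀ ℕ) : ℝ :=
  ∫ x in M.cellSet K, (∏ j, x j ^ m j) * ∏ j, x j ^ m' j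

theorem massEntry_comm (K : M.Cell) (m m' : Fin d →₀ ℕ) :
    massEntry K m m' = massEntry K m' m := by
  simp only [massEntry, mul_comm]

theorem eval_eq_sum_of_support_subset {p : MvPolynomial (Fin d) ℝ} {S : Finset (Fin d →₀ ℕ)}
    (h : p.support ⊆ S) (x : Fin d → ℝ) :
    MvPolynomial.eval x p = ∑ m ∈ S, p.coeff m * ∏ j, x j ^ m j := by
  rw [MvPolynomial.eval_eq']
  refine Finset.sum_subset h fun m _ hm => ?_
  rw [MvPolynomial.notMem_support_iff.1 hm, zero_mul]

/-- With one finite set `S` of monomials for all times, the inner product is a fixed mass matrix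
applied to coefficients, which reduces time regularity to that of the coefficients. -/
theorem ipV_eq_sum {v w : M.BrokenVector} {S : Finset (Fin d →₀ ℕ)}
    (hv : ∀ K i, (v K i).support ⊆ S) (hw : ∀ K i, (w K i).support ⊆ S) :
    ipV v w = ∑ K : M.Cell, ∑ i, ∑ m ∈ S, ∑ m' ∈ S,
      (v K i).coeff m * (w K i).coeff m' * massEntry K m m' := by
  refine Finset.sum_congr rfl fun K _ => ?_
  have hint : ∀ m m' : Fin d →₀ ℕ, Continuous fun x : E d =>
      (∏ j, x j ^ m j) * ∏ j, x j ^ m' j := by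
    intro m m'
    fun_prop
  have h : ∀ x, inner ℝ (vval v K x) (vval w K x) = ∑ i, ∑ m ∈ S, ∑ m' ∈ S,
      (v K i).coeff m * (w K i).coeff m' * ((∏ j, x j ^ m j) * ∏ j, x j ^ m' j) := by
    intro x
    simp only [PiLp.inner_apply, vval, RCLike.inner_apply, conj_trivial]
    refine Finset.sum_congr rfl fun i _ => ?_
    rw [eval_eq_sum_of_support_subset (hv K i), eval_eq_sum_of_support_subset (hw K i), mul_comm,
      Finset.sum_mul_sum]
    exact Finset.sum_congr rfl fun m _ => Finset.sum_congr rfl fun m' _ => by ring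
  have hi : ∀ (i : Fin d) (m m' : Fin d →₀ ℕ), Integrable (fun x : E d =>
      (v K i).coeff m * (w K i).coeff m' * ((∏ j, x j ^ m j) * ∏ j, x j ^ m' j))
      (volume.restrict (M.cellSet K)) := fun i m m' =>
    (continuous_const.mul (hint m m')).continuousOn.integrableOn_compact (isCompact_cellSet K)
  simp only [h]
  rw [integral_finsetSum _ fun i _ => integrable_finsetSum _ fun m _ =>
    integrable_finsetSum _ fun m' _ => hi i m m']
  refine Finset.sum_congr rfl fun i _ => ?_
  rw [integral_finsetSum _ fun m _ => integrable_finsetSum _ fun m' _ => hi i m m']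
  refine Finset.sum_congr rfl fun m _ => ?_
  rw [integral_finsetSum _ fun m' _ => hi i m m']
  exact Finset.sum_congr rfl fun m' _ => integral_const_mul _ _

end Mesh

/-! ### Dissipation in time and stability of the schemes -/

namespace OrientedMesh

open Mesh

variable {d : ℕ} {Ω : Set (E d)} {M : OrientedMesh d Ω}

theorem exists_finset_support_subset (d N : ℕ) : ∃ S : Finset (Fin d →₀ ℕ),
    ∀ p : MvPolynomial (Fin d) ℝ, p.totalDegree ≤ N → p.support ⊆ S := by
  refine ⟨(Finsupp.finite_of_degree_le N).toFinset, fun p hp m hm => ?_⟩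
  rw [Set.Finite.mem_toFinset]
  exact (MvPolynomial.le_totalDegree hm).trans hp

theorem continuousOn_ipV {T : ℝ} {N : ℕ} {u : ℝ → M.BrokenVector}
    (hN : ∀ t ∈ Icc 0 T, ∀ K i, (u t K i).totalDegree ≤ N) (hu : ContinuousInTime T u) :
    ContinuousOn (fun t => ipV (u t) (u t)) (Icc 0 T) := by
  obtain ⟨S, hS⟩ := exists_finset_support_subset d N
  refine ContinuousOn.congr (f := fun t => ∑ K : M.toMesh.Cell, ∑ i, ∑ m ∈ S, ∑ m' ∈ S,
      (u t K i).coeff m * (u t K i).coeff m' * massEntry K m m') ?_ fun t ht =>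
    ipV_eq_sum (fun K i => hS _ (hN t ht K i)) (fun K i => hS _ (hN t ht K i))
  exact continuousOn_finsetSum _ fun K _ => continuousOn_finsetSum _ fun i _ =>
    continuousOn_finsetSum _ fun m _ => continuousOn_finsetSum _ fun m' _ =>
      ((hu K i m).mul (hu K i m')).mul continuousOn_const

theorem hasDerivWithinAt_ipV {T : ℝ} {N : ℕ} {u : ℝ → M.BrokenVector} {u' : M.BrokenVector}
    (hN : ∀ t ∈ Icc 0 T, ∀ K i, (u t K i).totalDegree ≤ N) {t : ℝ} (ht : t ∈ Icc 0 T)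
    (hu : HasTimeDeriv T u u' t) :
    HasDerivWithinAt (fun t => ipV (u t) (u t)) (2 * ipV u' (u t)) (Icc 0 T) t := by
  classical
  obtain ⟨S₀, hS₀⟩ := exists_finset_support_subset d N
  -- The derivative `u'` comes without a degree bound, so its monomials are adjoined.
  let S := S₀ ∪ Finset.univ.biUnion fun K => Finset.univ.biUnion fun i => (u' K i).support
  have hS : ∀ t ∈ Icc 0 T, ∀ K i, (u t K i).support ⊆ S := fun t ht K i =>
    (hS₀ _ (hN t ht K i)).trans Finset.subset_union_left
  have hS' : ∀ K i, (u' K i).support ⊆ S := fun K i =>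
    ((Finset.subset_biUnion_of_mem (fun i => (u' K i).support) (Finset.mem_univ i)).trans
      (Finset.subset_biUnion_of_mem
        (fun K => Finset.univ.biUnion fun i => (u' K i).support) (Finset.mem_univ K))).trans
      Finset.subset_union_right
  have hd : HasDerivWithinAt (fun t => ∑ K : M.toMesh.Cell, ∑ i, ∑ m ∈ S, ∑ m' ∈ S,
      (u t K i).coeff m * (u t K i).coeff m' * massEntry K m m')
      (∑ K : M.toMesh.Cell, ∑ i, ∑ m ∈ S, ∑ m' ∈ S,
        ((u' K i).coeff m * (u t K i).coeff m' + (u t K i).coeff m * (u' K i).coeff m') *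
          massEntry K m m') (Icc 0 T) t :=
    HasDerivWithinAt.fun_sum fun K _ => HasDerivWithinAt.fun_sum fun i _ =>
      HasDerivWithinAt.fun_sum fun m _ => HasDerivWithinAt.fun_sum fun m' _ =>
        ((hu K i m).mul (hu K i m')).mul_const _
  have hsum : 2 * ipV u' (u t) = ∑ K : M.toMesh.Cell, ∑ i, ∑ m ∈ S, ∑ m' ∈ S,
      ((u' K i).coeff m * (u t K i).coeff m' + (u t K i).coeff m * (u' K i).coeff m') *
        massEntry K m m' := by
    rw [two_mul]
    simp only [add_mul, Finset.sum_add_distrib]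
    rw [ipV_eq_sum hS' (hS t ht)]
    refine congrArg _ (Finset.sum_congr rfl fun K _ => Finset.sum_congr rfl fun i _ => ?_)
    -- Renaming `m` and `m'` and the symmetry of the mass matrix identify the two halves of the
    -- product rule.
    rw [Finset.sum_comm]
    refine Finset.sum_congr rfl fun m _ => Finset.sum_congr rfl fun m' _ => ?_
    rw [massEntry_comm]
    ring
  rw [hsum]
  exact hd.congr (fun s hs => ipV_eq_sum (hS s hs) (hS s hs)) (ipV_eq_sum (hS t ht) (hS t ht))

/-- Fields whose energy is dissipated have decreasing `L²` norm. -/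
theorem normL2_le_of_dissipation {T : ℝ} {N : ℕ} {u : ℝ → M.BrokenVector}
    (hN : ∀ t ∈ Icc 0 T, ∀ K i, (u t K i).totalDegree ≤ N) (hu : ContinuousInTime T u)
    (hdiss : ∀ t ∈ Ioc 0 T, ∃ u' : M.BrokenVector, HasTimeDeriv T u u' t ∧ ipV u' (u t) ≤ 0)
    {t : ℝ} (ht : t ∈ Icc 0 T) : normL2 (u t) ≤ normL2 (u 0) := by
  refine normL2_le_of_ipV_le ?_
  -- The sign of the derivative is needed only inside the interval; continuity carries monotonicity
  -- to the endpoints.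
  have hderiv : ∀ s ∈ interior (Icc 0 T), ∃ c ≤ 0,
      HasDerivAt (fun t => ipV (u t) (u t)) c s := by
    intro s hs
    rw [interior_Icc] at hs
    obtain ⟨u', hu', hle⟩ := hdiss s (Ioo_subset_Ioc_self hs)
    exact ⟨2 * ipV u' (u s), by linarith,
      (hasDerivWithinAt_ipV hN (Ioo_subset_Icc_self hs) hu').hasDerivAt
        (Icc_mem_nhds hs.1 hs.2)⟩
  have hanti : AntitoneOn (fun t => ipV (u t) (u t)) (Icc 0 T) := by
    refine antitoneOn_of_deriv_nonpos (convex_Icc 0 T) (continuousOn_ipV hN hu) ?_ ?_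
    · intro s hs
      obtain ⟨c, _, hc⟩ := hderiv s hs
      exact hc.differentiableAt.differentiableWithinAt
    · intro s hs
      obtain ⟨c, hc0, hc⟩ := hderiv s hs
      rw [hc.deriv]
      exact hc0
  exact hanti ⟨le_rfl, ht.1.trans ht.2⟩ ht ht.1

theorem totalDegree_le_of_mem_shape {k : ℕ} {fam : HdivFamily}
    {v : Fin d → MvPolynomial (Fin d) ℝ} (hv : v ∈ shape d k fam) (i : Fin d) :
    (v i).totalDegree ≤ k + 1 := by
  cases fam with
  | raviartThomas =>
    obtain ⟨a, p, ha, hp, h⟩ := hv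
    rw [h i]
    refine (MvPolynomial.totalDegree_add _ _).trans (max_le ((ha i).trans k.le_succ) ?_)
    refine (MvPolynomial.totalDegree_mul _ _).trans ?_
    rw [MvPolynomial.totalDegree_X]
    exact Nat.add_le_add_right hp 1
  | brezziDouglasMarini => exact hv i

/-- Stability of the semi-discrete dG scheme with a dissipative convective form. -/
theorem SolvesDG.normL2_le {c : M.BrokenVector → M.BrokenVector → ℝ} {k : ℕ} {γ T : ℝ}
    {u : ℝ → M.BrokenVector} {P : ℝ → M.BrokenScalar} (h : SolvesDG c k γ T u P) (hγ : 0 ≤ γ)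
    (hc : ∀ v, 0 ≤ c v v) {t : ℝ} (ht : t ∈ Icc 0 T) : normL2 (u t) ≤ normL2 (u 0) := by
  refine normL2_le_of_dissipation h.mem_Vh h.cont (fun s hs => ?_) ht
  obtain ⟨u', hu', hmom⟩ := h.momentum s hs
  refine ⟨u', hu', ?_⟩
  -- Testing with the solution itself, so that the pressure term is the mass equation tested with
  -- `P`.
  have h1 := hmom _ (h.mem_Vh s (Ioc_subset_Icc_self hs))
  have h2 := h.mass s hs _ (h.mem_Qh s hs)
  linarith [hc (u s), pen_self_nonneg hγ (u s)]

/-- Stability of the semi-discrete `H(div)` scheme with a convective form that is dissipative on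
fields with zero normal component on the boundary. -/
theorem SolvesHdiv.normL2_le {c : M.BrokenVector → M.BrokenVector → ℝ} {fam : HdivFamily} {k : ℕ}
    {T : ℝ} {u : ℝ → M.BrokenVector} {P : ℝ → M.BrokenScalar} (h : SolvesHdiv c fam k T u P)
    (hc : ∀ v ∈ M.VhDiv fam k, 0 ≤ c v v) {t : ℝ} (ht : t ∈ Icc 0 T) :
    normL2 (u t) ≤ normL2 (u 0) := by
  refine normL2_le_of_dissipation
    (fun s hs K i => totalDegree_le_of_mem_shape ((h.mem_VhDiv s hs).2.1 K) i) h.cont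
    (fun s hs => ?_) ht
  obtain ⟨u', hu', hmom⟩ := h.momentum s hs
  have hV := h.mem_VhDiv s (Ioc_subset_Icc_self hs)
  refine ⟨u', hu', ?_⟩
  have h1 := hmom _ hV
  have h2 := h.mass s hs _ (h.mem_Qh s hs)
  linarith [hc _ hV]

end OrientedMesh

end EulerDG

end

theorem theorem1 {d : ℕ} (hd : d = 2 ∨ d = 3) {Ω : Set (EulerDG.E d)}
    (M : EulerDG.OrientedMesh d Ω) (k : ℕ) (θ γ T : ℝ) (hγ : 0 ≤ γ)
    (ζ : M.Facet → ℝ) (hζ : ∀ F, 0 ≤ ζ F) :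
    -- dG1 and dG2
    ((∀ F, M.IsBoundary F → 0.5 * |1 - θ| ≤ ζ F) →
      (∀ (u : ℝ → M.BrokenVector) (P : ℝ → M.BrokenScalar),
        EulerDG.OrientedMesh.SolvesDG1 θ ζ k γ T u P →
        ∀ t ∈ Set.Icc 0 T, EulerDG.normL2 (u t) ≤ EulerDG.normL2 (u 0)) ∧
      (∀ (u : ℝ → M.BrokenVector) (P : ℝ → M.BrokenScalar),
        EulerDG.OrientedMesh.SolvesDG2 θ ζ k γ T u P →
        ∀ t ∈ Set.Icc 0 T, EulerDG.normL2 (u t) ≤ EulerDG.normL2 (u 0))) ∧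
    -- Hdiv, for both element families and both convective forms
    (∀ (fam : EulerDG.OrientedMesh.HdivFamily) (c : M.BrokenVector → M.BrokenVector → ℝ),
      c = EulerDG.OrientedMesh.c1 θ ζ ∨ c = EulerDG.OrientedMesh.c2 θ ζ →
      ∀ (u : ℝ → M.BrokenVector) (P : ℝ → M.BrokenScalar),
        EulerDG.OrientedMesh.SolvesHdiv c fam k T u P →
        ∀ t ∈ Set.Icc 0 T, EulerDG.normL2 (u t) ≤ EulerDG.normL2 (u 0)) := by
  have hd0 : 0 < d := by omega
  refine ⟨fun hb => ?_, ?_⟩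
  · have hc := EulerDG.OrientedMesh.c1_self_nonneg_of_boundary hd0 hζ
      (fun F hF => by have := hb F hF; norm_num at this ⊢; exact this)
    exact ⟨fun u P h t ht => EulerDG.OrientedMesh.SolvesDG.normL2_le h hγ hc ht,
      fun u P h t ht => EulerDG.OrientedMesh.SolvesDG.normL2_le h hγ
        (fun v => (hc v).trans_eq (EulerDG.OrientedMesh.c2_self θ ζ v).symm) ht⟩
  · intro fam c hc u P h t ht
    refine EulerDG.OrientedMesh.SolvesHdiv.normL2_le h (fun v hv => ?_) ht
    have h1 := EulerDG.OrientedMesh.c1_self_nonneg_of_normal_eq_zero hd0 (θ := θ) hζ hv.2.2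
    rcases hc with rfl | rfl
    · exact h1
    · exact h1.trans_eq (EulerDG.OrientedMesh.c2_self θ ζ v).symm
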